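/- Let $n\ge 1$ and let $K$ be a convex body in $\mathbb R^n$ (compact, convex, with non-empty interior) with $K=-K$. Write $|\cdot|$ for $n$-dimensional volume and $v_n$ for the volume of the Euclidean unit ball. For $x\in K$ let $K^x=\{y:\langle y,z-x\rangle\le 1 \text{ for all } z\in K\}$ be the polar body of $K$ with respect to $x$, with $K^0$ the one for $x=0$, and for $t\in\mathbb R$ let $S(K,t)=\{x\in K: |K||K^x|/v_n^2\le t\}$ be the Santaló region. Let $E(K^0)$ be the Binet ellipsoid of $K^0$, the unit ball of the norm given by $\|u\|_{E(K^0)}^2=\frac1{|K^0|}\int_{K^0}\langle y,u\rangle^2\,dy$. For every $t\in\mathbb R$ with $S(K,t)\ne\emptyset$ one has $t\ge |K||K^0|/v_n^2$ and $$d_n(t)\,E(K^0)\subseteq S(K,t)\subseteq c_n(t)\,E(K^0),$$ where $$d_n(t)=\frac1{\sqrt3\,n}\Bigl(1-\frac{|K||K^0|}{tv_n^2}\Bigr)^{1/2}$$ and $$c_n(t)=\min\Bigl\{\Bigl(\frac{2}{(n+1)(n+2)}\Bigr)^{1/2}\Bigl(\frac{tv_n^2}{|K||K^0|}\Bigr)^{1/2}\Bigl(1-\frac{|K||K^0|}{tv_n^2}\Bigr)^{1/2},\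 \sqrt2\,\Bigl(1-\Bigl(\frac{|K||K^0|}{tv_n^2}\Bigr)^{1/n}\Bigr)^{1/2}\Bigr\}.$$ Consequently, if $t>|K||K^0|/v_n^2$, then $S(K,t)$ and $E(K^0)$ are convex bodies symmetric about the origin, and $$d(S(K,t),E(K^0))\le\Bigl(\frac{6tv_n^2}{|K||K^0|}\Bigr)^{1/2},$$ where $d(A,B)=\inf\{\|T\|\,\|T^{-1}\|\}$ is the Banach–Mazur distance, the infimum being over all linear isomorphisms $T:(\mathbb R^n,\|\cdot\|_A)\to(\mathbb R^n,\|\cdot\|_B)$, with $\|\cdot\|_A$ the norm whose unit ball is $A$. -/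

import Mathlib

open MeasureTheory
open scoped Pointwise

/-- Convex bodies of `ℝⁿ` (compact convex sets with non-empty interior) that are centrally
symmetric about the origin. -/
structure IsSymmConvexBody {n : ℕ} (K : Set (EuclideanSpace ℝ (Fin n))) : Prop where
  convex : Convex ℝ K
  isCompact : IsCompact K
  nonempty_interior : (interior K).Nonempty
  neg_mem : ∀ x ∈ K, -x ∈ K

/-- The polar body `K^x = (K - x)^0 = {y : ⟨y, z - x⟩ ≤ 1 for all z ∈ K}` of `K` with respect
to the point `x`. -/
def polarAt {n : ℕ} (K : Set (EuclideanSpace ℝ (Fin n))) (x : EuclideanSpace ℝ (Fin n)) :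
    Set (EuclideanSpace ℝ (Fin n)) :=
  {y | ∀ z ∈ K, inner ℝ y (z - x) ≤ 1}

/-- The volume `v_n` of the Euclidean unit ball of `ℝⁿ`. -/
noncomputable def unitBallVolume (n : ℕ) : ℝ :=
  volume.real (Metric.ball (0 : EuclideanSpace ℝ (Fin n)) 1)

/-- The Santaló region `S(K, t) = {x ∈ K : |K| |K^x| / v_n² ≤ t}`. For `x` in the boundary of
`K` the volume `|K^x|` is infinite, and such points do not belong to `S(K, t)`; this is what the
finiteness condition expresses. -/
def santaloRegion {n : ℕ} (K : Set (EuclideanSpace ℝ (Fin n))) (t : ℝ) :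
    Set (EuclideanSpace ℝ (Fin n)) :=
  {x | x ∈ K ∧ volume (polarAt K x) ≠ ⊤ ∧
    volume.real K * volume.real (polarAt K x) / unitBallVolume n ^ 2 ≤ t}

/-- The Binet ellipsoid `E(K)`: the unit ball of the norm given by
`‖u‖² = |K|⁻¹ ∫_K ⟨x, u⟩² dx`. -/
noncomputable def binetEllipsoid {n : ℕ} (K : Set (EuclideanSpace ℝ (Fin n))) :
    Set (EuclideanSpace ℝ (Fin n)) :=
  {u | 1 / volume.real K * ∫ x in K, (inner ℝ x u) ^ 2 ≤ 1}

/-- `d_n(t) = (1 / (√3 n)) (1 - |K| |K^0| / (t v_n²))^{1/2}`. -/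
noncomputable def innerRadius {n : ℕ} (K : Set (EuclideanSpace ℝ (Fin n))) (t : ℝ) : ℝ :=
  1 / (√3 * n) *
    √(1 - volume.real K * volume.real (polarAt K 0) / (t * unitBallVolume n ^ 2))

/-- `c_n(t)`, the minimum of
`(2 / ((n+1)(n+2)))^{1/2} (t v_n² / (|K| |K^0|))^{1/2} (1 - |K| |K^0| / (t v_n²))^{1/2}` and
`√2 (1 - (|K| |K^0| / (t v_n²))^{1/n})^{1/2}`. -/
noncomputable def outerRadius {n : ℕ} (K : Set (EuclideanSpace ℝ (Fin n))) (t : ℝ) : ℝ :=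
  min
    (√(2 / (((n : ℝ) + 1) * ((n : ℝ) + 2))) *
      √(t * unitBallVolume n ^ 2 / (volume.real K * volume.real (polarAt K 0))) *
      √(1 - volume.real K * volume.real (polarAt K 0) / (t * unitBallVolume n ^ 2)))
    (√2 *
      √(1 - (volume.real K * volume.real (polarAt K 0) / (t * unitBallVolume n ^ 2)) ^
        (1 / (n : ℝ))))

/-- The operator norm of a linear map `T : (ℝⁿ, ‖·‖_K) → (ℝⁿ, ‖·‖_L)`, where `‖·‖_K` is the norm
with unit ball `K`, that is, the gauge of `K`. -/
noncomputable def bodyOpNorm {n : ℕ} (K L : Set (EuclideanSpace ℝ (Fin n)))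
    (T : EuclideanSpace ℝ (Fin n) →ₗ[ℝ] EuclideanSpace ℝ (Fin n)) : ℝ :=
  sInf {c : ℝ | 0 ≤ c ∧ ∀ x, gauge L (T x) ≤ c * gauge K x}

/-- The Banach–Mazur distance `d(K, L) = inf {‖T‖ ‖T⁻¹‖}` of two symmetric convex bodies,
the infimum being over all linear isomorphisms `T : (ℝⁿ, ‖·‖_K) → (ℝⁿ, ‖·‖_L)`. -/
noncomputable def banachMazurDist {n : ℕ} (K L : Set (EuclideanSpace ℝ (Fin n))) : ℝ :=
  ⨅ T : EuclideanSpace ℝ (Fin n) ≃ₗ[ℝ] EuclideanSpace ℝ (Fin n),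
    bodyOpNorm K L (T : EuclideanSpace ℝ (Fin n) →ₗ[ℝ] EuclideanSpace ℝ (Fin n)) *
      bodyOpNorm L K (T.symm : EuclideanSpace ℝ (Fin n) →ₗ[ℝ] EuclideanSpace ℝ (Fin n))

/-!
Let `L = K⁰`. The projective map `y ↦ y / (1 - ⟨y, x⟩)` carries `L` to `K^x` with Jacobian
`(1 - ⟨y, x⟩)⁻⁽ⁿ⁺¹⁾`, so that for every `x ∈ K`

  `|K^x| = ∫_L (1 - ⟨y, x⟩)⁻⁽ⁿ⁺¹⁾ dy`                              (`volume_polarAt`).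

This makes `x ↦ |K^x|` even, convex and lower semicontinuous on `K`, whence the Santaló regions are
symmetric, convex and closed. Since `L = -L`, only the even part
`φ(s) = ((1 - s)⁻⁽ⁿ⁺¹⁾ + (1 + s)⁻⁽ⁿ⁺¹⁾) / 2` of the kernel matters, and the theorem compares
`∫_L φ(⟨y, x⟩) dy` with the second moment `q(x) = |L|⁻¹ ∫_L ⟨y, x⟩² dy` that defines the Binet
ellipsoid.

*Outer inclusion.* The pointwise bounds `φ(s) ≥ 1 + (n + 1) (n + 2) s² / 2` and
`φ(s) ≥ (1 - s² / 2)⁻ⁿ`, the second one replaced by its tangent line in `s²` at `q(x)`, integrate to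
`|K^x| ≥ |L| (1 + (n + 1) (n + 2) q(x) / 2)` and `|K^x| ≥ |L| (1 - q(x) / 2)⁻ⁿ`. They give the two
terms of `outerRadius`.

*Inner inclusion.* Here a reverse inequality is needed (`IsSymmConvexBody.lintegral_kernel_le`):
with `α² = (n + 1) (n + 2) q(x) / 2`, if `α < 1` then `|⟨y, x⟩| ≤ α` on `L`, which puts `x` into `K`
by the bipolar theorem, and `|K^x| ≤ |L| / (1 - α²)`. Equality holds for the double cone. Let `N(r)`
be the volume of `{y ∈ L : |⟨y, x⟩| > r}`. By the Brunn–Minkowski inequality, `N^(1/n)` lies above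
its chords from `0`, while for the cone profile `G(r) = |L| (1 - r / α)ⁿ` the function `G^(1/n)` is
linear; so `N - G` changes sign at most once, from `+` to `-`. The number `α` is chosen such that
`∫ r N = ∫ r G`. As `φ'(r) / r` increases, `∫ φ' N ≤ ∫ φ' G`, which is the claim by the layer cake
formula. Finally `(n + 1) (n + 2) / 2 ≤ 3 n²`.

The Brunn–Minkowski inequality is deduced from the Prékopa–Leindler inequality, proved by induction
on the dimension. The bound for the Banach–Mazur distance is obtained from the identity map and the
first of the two outer radii.
-/

open scoped ENNReal

/-! ### The Prékopa–Leindler and Brunn–Minkowski inequalities -/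

theorem ENNReal.geom_mean_le_arith_mean2_weighted {a b : ℝ} (ha : 0 < a) (hb : 0 < b)
    (hab : a + b = 1) (u v : ℝ≥0∞) :
    u ^ a * v ^ b ≤ ENNReal.ofReal a * u + ENNReal.ofReal b * v := by
  have ha' : ENNReal.ofReal a ≠ 0 := by simpa using ha
  have hb' : ENNReal.ofReal b ≠ 0 := by simpa using hb
  rcases eq_or_ne u ⊤ with rfl | hu
  · simp [ENNReal.mul_top ha']
  rcases eq_or_ne v ⊤ with rfl | hv
  · simp [ENNReal.mul_top hb']
  lift u to NNReal using hu
  lift v to NNReal using hv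
  have h := NNReal.geom_mean_le_arith_mean2_weighted a.toNNReal b.toNNReal u v
    (by rw [← Real.toNNReal_add ha.le hb.le, hab, Real.toNNReal_one])
  rw [Real.coe_toNNReal _ ha.le, Real.coe_toNNReal _ hb.le] at h
  rw [← ENNReal.coe_rpow_of_nonneg _ ha.le, ← ENNReal.coe_rpow_of_nonneg _ hb.le,
    ENNReal.ofReal, ENNReal.ofReal]
  exact_mod_cast h

/-- The Brunn–Minkowski inequality on the line: for compact `A` and `B`, a translate of `A` and a
translate of `B` that meet in a single point lie in `A + B`. -/
theorem Real.volume_add_volume_le {A B C : Set ℝ} (hA : MeasurableSet A) (hB : MeasurableSet B)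
    (hAn : A.Nonempty) (hBn : B.Nonempty) (h : ∀ x ∈ A, ∀ y ∈ B, x + y ∈ C) :
    volume A + volume B ≤ volume C := by
  have trans_left : ∀ (q : ℝ) (s : Set ℝ), volume ((fun x => q + x) '' s) = volume s := by
    intro q s
    simp
  obtain ⟨x₀, hx₀⟩ := hAn
  obtain ⟨y₀, hy₀⟩ := hBn
  have hAC : volume A ≤ volume C := by
    rw [← trans_left y₀ A]
    refine measure_mono ?_
    rintro _ ⟨x, hx, rfl⟩
    simpa [add_comm] using h x hx y₀ hy₀
  have hBC : volume B ≤ volume C := by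
    rw [← trans_left x₀ B]
    refine measure_mono ?_
    rintro _ ⟨y, hy, rfl⟩
    exact h x₀ hx₀ y hy
  rcases eq_or_ne (volume A) 0 with hA0 | hA0
  · simpa [hA0] using hBC
  rcases eq_or_ne (volume B) 0 with hB0 | hB0
  · simpa [hB0] using hAC
  refine le_of_forall_lt fun c hc => ?_
  obtain ⟨u, hu, v, hv, hcuv⟩ := ENNReal.exists_lt_add_of_lt_add hc hA0 hB0
  obtain ⟨K, hKA, hK, huK⟩ := hA.exists_lt_isCompact hu
  obtain ⟨J, hJB, hJ, hvJ⟩ := hB.exists_lt_isCompact hv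
  have hKn : K.Nonempty := nonempty_of_measure_ne_zero (bot_le.trans_lt huK).ne'
  have hJn : J.Nonempty := nonempty_of_measure_ne_zero (bot_le.trans_lt hvJ).ne'
  obtain ⟨p, hpK, hp⟩ := hK.exists_isGreatest hKn
  obtain ⟨q, hqJ, hq⟩ := hJ.exists_isLeast hJn
  have hdisj : AEDisjoint volume ((fun x => q + x) '' K) ((fun x => p + x) '' J) := by
    refine measure_mono_null (t := {p + q}) ?_ (measure_singleton _)
    rintro _ ⟨⟨x, hx, rfl⟩, ⟨y, hy, hxy⟩⟩
    have h1 := hp hx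
    have h2 := hq hy
    simp only [Set.mem_singleton_iff] at hxy ⊢
    linarith
  have hJm : MeasurableSet ((fun x => p + x) '' J) :=
    (hJ.image (continuous_const.add continuous_id)).measurableSet
  calc c < u + v := hcuv
    _ ≤ volume K + volume J := add_le_add huK.le hvJ.le
    _ = volume ((fun x => q + x) '' K ∪ (fun x => p + x) '' J) := by
      rw [measure_union₀ hJm.nullMeasurableSet hdisj, trans_left, trans_left]
    _ ≤ volume C := by
      refine measure_mono ?_
      rintro _ (⟨x, hx, rfl⟩ | ⟨y, hy, rfl⟩)
      · simpa [add_comm] using h x (hKA hx) q (hJB hqJ)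
      · exact h p (hKA hpK) y (hJB hy)

theorem Real.volume_combination_le {a b : ℝ} (ha : 0 < a) (hb : 0 < b) {A B C : Set ℝ}
    (hA : MeasurableSet A) (hB : MeasurableSet B)
    (hAn : A.Nonempty) (hBn : B.Nonempty) (h : ∀ x ∈ A, ∀ y ∈ B, a * x + b * y ∈ C) :
    ENNReal.ofReal a * volume A + ENNReal.ofReal b * volume B ≤ volume C := by
  have key := Real.volume_add_volume_le (A := a • A) (B := b • B) (C := C)
    (hA.const_smul₀ a) (hB.const_smul₀ b) (hAn.image _) (hBn.image _) (by
      rintro _ ⟨x, hx, rfl⟩ _ ⟨y, hy, rfl⟩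
      exact h x hx y hy)
  simpa [Measure.addHaar_smul, abs_of_pos ha, abs_of_pos hb] using key

/-- Layer cake formula for the truncation at height `1`. -/
theorem lintegral_min_one_eq {f : ℝ → ℝ≥0∞} (hf : Measurable f) :
    ∫⁻ x, min (f x) 1 = ∫⁻ r in Set.Ioo (0 : ℝ) 1, volume {x | ENNReal.ofReal r < f x} := by
  have hne : ∀ x, min (f x) 1 ≠ ⊤ := fun x => ne_top_of_le_ne_top ENNReal.one_ne_top
    (min_le_right _ _)
  have h1 : ∫⁻ x, min (f x) 1 = ∫⁻ x, ENNReal.ofReal (min (f x) 1).toReal := by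
    simp_rw [ENNReal.ofReal_toReal (hne _)]
  rw [h1, lintegral_eq_lintegral_meas_lt _ (Filter.Eventually.of_forall fun x =>
    ENNReal.toReal_nonneg) (hf.min measurable_const).ennreal_toReal.aemeasurable]
  rw [← lintegral_indicator measurableSet_Ioi, ← lintegral_indicator measurableSet_Ioo]
  congr 1
  ext r
  by_cases hr0 : 0 < r
  swap
  · simp [hr0]
  have hset : {x | r < (min (f x) 1).toReal} = {x | ENNReal.ofReal r < min (f x) 1} := by
    ext x
    exact (ENNReal.ofReal_lt_iff_lt_toReal hr0.le (hne x)).symm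
  by_cases hr1 : r < 1
  · simp only [Set.indicator, Set.mem_Ioi, hr0, if_true, hset, Set.mem_Ioo, hr1, and_self]
    congr 1
    ext x
    simp [hr1]
  · simp [Set.indicator, hr0, hr1, hset]

/-- The one-dimensional Prékopa–Leindler inequality, in its arithmetic form, for functions with
supremum `1`. -/
theorem prekopa_leindler_real_of_iSup_eq_one {a b : ℝ} (ha : 0 < a) (hb : 0 < b)
    (hab : a + b = 1) {f g h : ℝ → ℝ≥0∞} (hf : Measurable f) (hg : Measurable g)
    (hh : Measurable h) (hfs : (⨆ x, f x) = 1) (hgs : (⨆ x, g x) = 1)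
    (H : ∀ x y, f x ^ a * g y ^ b ≤ h (a * x + b * y)) :
    ENNReal.ofReal a * (∫⁻ x, f x) + ENNReal.ofReal b * (∫⁻ x, g x) ≤ ∫⁻ x, h x := by
  have hf1 : ∀ x, min (f x) 1 = f x := fun x => min_eq_left (hfs ▸ le_iSup f x)
  have hg1 : ∀ x, min (g x) 1 = g x := fun x => min_eq_left (hgs ▸ le_iSup g x)
  calc ENNReal.ofReal a * (∫⁻ x, f x) + ENNReal.ofReal b * (∫⁻ x, g x)
      = ENNReal.ofReal a * (∫⁻ r in Set.Ioo (0 : ℝ) 1, volume {x | ENNReal.ofReal r < f x})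
        + ENNReal.ofReal b * ∫⁻ r in Set.Ioo (0 : ℝ) 1, volume {x | ENNReal.ofReal r < g x} := by
        rw [← lintegral_min_one_eq hf, ← lintegral_min_one_eq hg]
        simp_rw [hf1, hg1]
    _ ≤ ∫⁻ r in Set.Ioo (0 : ℝ) 1, (ENNReal.ofReal a * volume {x | ENNReal.ofReal r < f x} +
          ENNReal.ofReal b * volume {x | ENNReal.ofReal r < g x}) :=
        (add_le_add (lintegral_const_mul_le _ _) (lintegral_const_mul_le _ _)).trans
          (le_lintegral_add _ _)
    _ ≤ ∫⁻ r in Set.Ioo (0 : ℝ) 1, volume {x | ENNReal.ofReal r < h x} := by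
        refine setLIntegral_mono' measurableSet_Ioo fun r hr => ?_
        have hr1 : ENNReal.ofReal r < 1 := by simpa using hr.2
        have hfn : {x | ENNReal.ofReal r < f x}.Nonempty :=
          show ∃ x, _ < f x from lt_iSup_iff.1 (by rwa [hfs])
        have hgn : {x | ENNReal.ofReal r < g x}.Nonempty :=
          show ∃ x, _ < g x from lt_iSup_iff.1 (by rwa [hgs])
        refine Real.volume_combination_le ha hb (measurableSet_lt measurable_const hf)
          (measurableSet_lt measurable_const hg) hfn hgn ?_
        intro x hx y hy
        refine lt_of_lt_of_le ?_ (H x y)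
        have e : ENNReal.ofReal r = ENNReal.ofReal r ^ a * ENNReal.ofReal r ^ b := by
          rw [← ENNReal.rpow_add_of_nonneg _ _ ha.le hb.le, hab, ENNReal.rpow_one]
        rw [e]
        exact ENNReal.mul_lt_mul (ENNReal.rpow_lt_rpow hx ha) (ENNReal.rpow_lt_rpow hy hb)
    _ = ∫⁻ x, min (h x) 1 := (lintegral_min_one_eq hh).symm
    _ ≤ ∫⁻ x, h x := lintegral_mono fun x => min_le_left _ _

theorem prekopa_leindler_real_of_iSup_ne_top {a b : ℝ} (ha : 0 < a) (hb : 0 < b)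
    (hab : a + b = 1) {f g h : ℝ → ℝ≥0∞} (hf : Measurable f) (hg : Measurable g)
    (hh : Measurable h) (hfs : (⨆ x, f x) ≠ ⊤) (hgs : (⨆ x, g x) ≠ ⊤)
    (H : ∀ x y, f x ^ a * g y ^ b ≤ h (a * x + b * y)) :
    (∫⁻ x, f x) ^ a * (∫⁻ x, g x) ^ b ≤ ∫⁻ x, h x := by
  set M := ⨆ x, f x with hM
  set N := ⨆ x, g x with hN
  rcases eq_or_ne M 0 with hM0 | hM0
  · have : ∀ x, f x = 0 := by simpa [hM] using hM0
    simp [this, ha]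
  rcases eq_or_ne N 0 with hN0 | hN0
  · have : ∀ x, g x = 0 := by simpa [hN] using hN0
    simp [this, hb]
  set c := M ^ a * N ^ b with hc
  have hc0 : c ≠ 0 := by
    simp [hc, ENNReal.rpow_eq_zero_iff, hM0, hN0, ha.not_gt, hb.not_gt]
  have hct : c ≠ ⊤ := ENNReal.mul_ne_top (ENNReal.rpow_ne_top_of_nonneg ha.le hfs)
    (ENNReal.rpow_ne_top_of_nonneg hb.le hgs)
  have key := prekopa_leindler_real_of_iSup_eq_one ha hb hab (f := fun x => M⁻¹ * f x)
    (g := fun x => N⁻¹ * g x) (h := fun x => c⁻¹ * h x) (hf.const_mul _) (hg.const_mul _)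
    (hh.const_mul _) (by rw [← ENNReal.mul_iSup, ← hM, ENNReal.inv_mul_cancel hM0 hfs])
    (by rw [← ENNReal.mul_iSup, ← hN, ENNReal.inv_mul_cancel hN0 hgs]) (by
      intro x y
      have e : (M⁻¹ * f x) ^ a * (N⁻¹ * g y) ^ b = c⁻¹ * (f x ^ a * g y ^ b) := by
        rw [ENNReal.mul_rpow_of_nonneg _ _ ha.le, ENNReal.mul_rpow_of_nonneg _ _ hb.le,
          ENNReal.inv_rpow, ENNReal.inv_rpow, hc, ENNReal.mul_inv
            (Or.inr (ENNReal.rpow_ne_top_of_nonneg hb.le hgs))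
            (Or.inl (ENNReal.rpow_ne_top_of_nonneg ha.le hfs))]
        ring
      rw [e]
      gcongr
      exact H x y)
  rw [lintegral_const_mul _ hf, lintegral_const_mul _ hg, lintegral_const_mul _ hh] at key
  have hyoung := (ENNReal.geom_mean_le_arith_mean2_weighted ha hb hab _ _).trans key
  rw [ENNReal.mul_rpow_of_nonneg _ _ ha.le, ENNReal.mul_rpow_of_nonneg _ _ hb.le,
    ENNReal.inv_rpow, ENNReal.inv_rpow] at hyoung
  have e : (M ^ a)⁻¹ * (∫⁻ x, f x) ^ a * ((N ^ b)⁻¹ * (∫⁻ x, g x) ^ b)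
      = c⁻¹ * ((∫⁻ x, f x) ^ a * (∫⁻ x, g x) ^ b) := by
    rw [hc, ENNReal.mul_inv (Or.inr (ENNReal.rpow_ne_top_of_nonneg hb.le hgs))
            (Or.inl (ENNReal.rpow_ne_top_of_nonneg ha.le hfs))]
    ring
  rw [e] at hyoung
  exact (ENNReal.mul_le_mul_iff_right (ENNReal.inv_ne_zero.2 hct)
    (ENNReal.inv_ne_top.2 hc0)).1 hyoung

/-- The Prékopa–Leindler inequality on the line. -/
theorem prekopa_leindler_real {a b : ℝ} (ha : 0 < a) (hb : 0 < b)
    (hab : a + b = 1) {f g h : ℝ → ℝ≥0∞} (hf : Measurable f) (hg : Measurable g)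
    (hh : Measurable h) (H : ∀ x y, f x ^ a * g y ^ b ≤ h (a * x + b * y)) :
    (∫⁻ x, f x) ^ a * (∫⁻ x, g x) ^ b ≤ ∫⁻ x, h x := by
  have step : ∀ k : ℕ, (∫⁻ x, min (f x) k) ^ a * (∫⁻ x, min (g x) k) ^ b ≤ ∫⁻ x, h x := by
    intro k
    have hk : ∀ u : ℝ → ℝ≥0∞, (⨆ x, min (u x) (k : ℝ≥0∞)) ≠ ⊤ := fun u =>
      ne_top_of_le_ne_top (ENNReal.natCast_ne_top k) (iSup_le fun x => min_le_right _ _)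
    refine prekopa_leindler_real_of_iSup_ne_top ha hb hab (hf.min measurable_const)
      (hg.min measurable_const) hh (hk f) (hk g) fun x y => le_trans ?_ (H x y)
    gcongr <;> exact min_le_left _ _
  have lim : ∀ u : ℝ → ℝ≥0∞, Measurable u →
      Filter.Tendsto (fun k : ℕ => ∫⁻ x, min (u x) k) Filter.atTop (nhds (∫⁻ x, u x)) := by
    intro u hu
    refine lintegral_tendsto_of_tendsto_of_monotone
      (fun k => (hu.min measurable_const).aemeasurable) (Filter.Eventually.of_forall fun x => ?_)
      (Filter.Eventually.of_forall fun x => ?_)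
    · intro i j hij
      exact min_le_min le_rfl (by exact_mod_cast hij)
    · have := (tendsto_const_nhds (x := u x)).min ENNReal.tendsto_nat_nhds_top
      simpa using this
  rcases eq_or_ne ((∫⁻ x, f x) ^ a) 0 with h0 | h0
  · simp [h0]
  rcases eq_or_ne ((∫⁻ x, g x) ^ b) 0 with h0' | h0'
  · simp [h0']
  exact le_of_tendsto (ENNReal.Tendsto.mul ((lim f hf).ennrpow_const a) (Or.inl h0)
    ((lim g hg).ennrpow_const b) (Or.inl h0')) (Filter.Eventually.of_forall step)

/-- The Prékopa–Leindler inequality on `ℝⁿ`, by induction on `n`: integrating out all but the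
first coordinate preserves the hypothesis. -/
theorem prekopa_leindler_pi {a b : ℝ} (ha : 0 < a) (hb : 0 < b) (hab : a + b = 1) :
    ∀ (n : ℕ) {f g h : (Fin n → ℝ) → ℝ≥0∞}, Measurable f → Measurable g → Measurable h →
      (∀ x y, f x ^ a * g y ^ b ≤ h (a • x + b • y)) →
      (∫⁻ x, f x) ^ a * (∫⁻ x, g x) ^ b ≤ ∫⁻ x, h x := by
  intro n
  induction n with
  | zero =>
    intro f g h _ _ _ H
    have hv : ∀ u : (Fin 0 → ℝ) → ℝ≥0∞, ∫⁻ x, u x = u default := by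
      intro u
      rw [lintegral_unique, volume_pi, Measure.pi_univ, Finset.univ_eq_empty, Finset.prod_empty,
        mul_one]
      exact congrArg u (Subsingleton.elim _ _)
    rw [hv, hv, hv]
    exact (H default default).trans_eq (congrArg h (Subsingleton.elim _ _))
  | succ n ih =>
    intro f g h hf hg hh H
    have hcons_eq : ∀ p : ℝ × (Fin n → ℝ),
        (MeasurableEquiv.piFinSuccAbove (fun _ : Fin (n + 1) => ℝ) 0).symm p
          = Fin.cons p.1 p.2 := by
      intro p
      ext i
      refine Fin.cases ?_ (fun j => ?_) i <;> simp [MeasurableEquiv.piFinSuccAbove]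
    have hcons : Measurable fun p : ℝ × (Fin n → ℝ) => (Fin.cons p.1 p.2 : Fin (n + 1) → ℝ) :=
      funext hcons_eq ▸
        (MeasurableEquiv.piFinSuccAbove (fun _ : Fin (n + 1) => ℝ) 0).symm.measurable
    have fub : ∀ u : (Fin (n + 1) → ℝ) → ℝ≥0∞, Measurable u →
        ∫⁻ x, u x = ∫⁻ s : ℝ, ∫⁻ z : Fin n → ℝ, u (Fin.cons s z) := by
      intro u hu
      have hmp := (volume_preserving_piFinSuccAbove (fun _ : Fin (n + 1) => ℝ) 0).symm
      rw [← hmp.lintegral_comp hu]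
      simp_rw [hcons_eq]
      exact lintegral_prod _ (hu.comp hcons).aemeasurable
    rw [fub f hf, fub g hg, fub h hh]
    refine prekopa_leindler_real ha hb hab (hf.comp hcons).lintegral_prod_right'
      (hg.comp hcons).lintegral_prod_right' (hh.comp hcons).lintegral_prod_right' ?_
    intro s t
    refine ih (hf.comp (hcons.comp measurable_prodMk_left))
      (hg.comp (hcons.comp measurable_prodMk_left))
      (hh.comp (hcons.comp measurable_prodMk_left)) ?_
    intro x y
    convert H (Fin.cons s x) (Fin.cons t y) using 2
    ext i
    refine Fin.cases ?_ (fun j => ?_) i <;> simp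

/-- The multiplicative form of the Brunn–Minkowski inequality. -/
theorem brunn_minkowski_mul {n : ℕ} {a b : ℝ} (ha : 0 < a) (hb : 0 < b) (hab : a + b = 1)
    {A B C : Set (EuclideanSpace ℝ (Fin n))} (hA : MeasurableSet A) (hB : MeasurableSet B)
    (hC : MeasurableSet C) (h : ∀ x ∈ A, ∀ y ∈ B, a • x + b • y ∈ C) :
    volume A ^ a * volume B ^ b ≤ volume C := by
  have hmp := PiLp.volume_preserving_toLp (Fin n)
  have hv : ∀ S : Set (EuclideanSpace ℝ (Fin n)), MeasurableSet S →
      volume S = ∫⁻ x : Fin n → ℝ, S.indicator 1 (WithLp.toLp 2 x) := by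
    intro S hS
    rw [hmp.lintegral_comp (measurable_one.indicator hS), lintegral_indicator_one hS]
  rw [hv A hA, hv B hB, hv C hC]
  refine prekopa_leindler_pi ha hb hab n ((measurable_one.indicator hA).comp hmp.measurable)
    ((measurable_one.indicator hB).comp hmp.measurable)
    ((measurable_one.indicator hC).comp hmp.measurable) fun x y => ?_
  by_cases hx : WithLp.toLp 2 x ∈ A
  swap
  · simp [hx, ha]
  by_cases hy : WithLp.toLp 2 y ∈ B
  swap
  · simp [hy, hb]
  have := h _ hx _ hy
  simp [hx, hy, Set.indicator_of_mem this]

/-- The Brunn–Minkowski inequality. It follows from the multiplicative form by rescaling both sets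
to unit volume. -/
theorem brunn_minkowski {n : ℕ} (hn : n ≠ 0) {a b : ℝ} (ha : 0 < a) (hb : 0 < b)
    {A B C : Set (EuclideanSpace ℝ (Fin n))} (hA : MeasurableSet A) (hB : MeasurableSet B)
    (hC : MeasurableSet C) (hA0 : 0 < volume.real A) (hB0 : 0 < volume.real B)
    (hCt : volume C ≠ ⊤) (h : ∀ x ∈ A, ∀ y ∈ B, a • x + b • y ∈ C) :
    a * volume.real A ^ (1 / (n : ℝ)) + b * volume.real B ^ (1 / (n : ℝ)) ≤
      volume.real C ^ (1 / (n : ℝ)) := by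
  set α := volume.real A ^ (1 / (n : ℝ)) with hα
  set β := volume.real B ^ (1 / (n : ℝ)) with hβ
  have hα0 : 0 < α := Real.rpow_pos_of_pos hA0 _
  have hβ0 : 0 < β := Real.rpow_pos_of_pos hB0 _
  have hαn : α ^ n = volume.real A := by
    rw [hα, one_div, Real.rpow_inv_natCast_pow hA0.le hn]
  have hβn : β ^ n = volume.real B := by
    rw [hβ, one_div, Real.rpow_inv_natCast_pow hB0.le hn]
  set M := a * α + b * β with hM
  have hM0 : 0 < M := by positivity
  have hsc : ∀ (r : ℝ) (S : Set (EuclideanSpace ℝ (Fin n))), 0 < r →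
      volume (r⁻¹ • S) = ENNReal.ofReal ((r ^ n)⁻¹) * volume S := by
    intro r S hr
    rw [Measure.addHaar_smul, finrank_euclideanSpace_fin, inv_pow, abs_of_pos (by positivity)]
  have hunit : ∀ (r : ℝ) (S : Set (EuclideanSpace ℝ (Fin n))), 0 < r → r ^ n = volume.real S →
      volume (r⁻¹ • S) = 1 := by
    intro r S hr hS
    have ht : volume S ≠ ⊤ := by
      intro ht
      have : 0 < r ^ n := by positivity
      simp [hS, Measure.real, ht] at this
    rw [hsc r S hr, ← ENNReal.ofReal_toReal ht, ← ENNReal.ofReal_mul (by positivity)]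
    change ENNReal.ofReal ((r ^ n)⁻¹ * volume.real S) = 1
    rw [← hS, inv_mul_cancel₀ (by positivity), ENNReal.ofReal_one]
  have key := brunn_minkowski_mul (n := n) (a := a * α / M) (b := b * β / M)
    (A := α⁻¹ • A) (B := β⁻¹ • B) (C := M⁻¹ • C) (by positivity) (by positivity)
    (by rw [← add_div, ← hM, div_self hM0.ne']) (hA.const_smul₀ _) (hB.const_smul₀ _)
    (hC.const_smul₀ _) (by
      rintro _ ⟨x, hx, rfl⟩ _ ⟨y, hy, rfl⟩
      refine ⟨a • x + b • y, h x hx y hy, ?_⟩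
      simp only [smul_add, smul_smul]
      congr 2 <;> field_simp)
  rw [hunit α A hα0 hαn, hunit β B hβ0 hβn, ENNReal.one_rpow, ENNReal.one_rpow, one_mul,
    hsc M C hM0, ← ENNReal.ofReal_toReal hCt, ← ENNReal.ofReal_mul (by positivity),
    ENNReal.one_le_ofReal] at key
  change 1 ≤ (M ^ n)⁻¹ * volume.real C at key
  have hMC : M ^ n ≤ volume.real C := by
    rwa [inv_mul_eq_div, le_div_iff₀ (by positivity), one_mul] at key
  calc M = (M ^ n) ^ (1 / (n : ℝ)) := by rw [one_div, Real.pow_rpow_inv_natCast hM0.le hn]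
    _ ≤ _ := Real.rpow_le_rpow (by positivity) hMC (by positivity)

/-! ### Polar bodies and the volume of `K^x` -/

section PolarBody

variable {n : ℕ} {K : Set (EuclideanSpace ℝ (Fin n))}

theorem mem_polarAt_zero {y : EuclideanSpace ℝ (Fin n)} :
    y ∈ polarAt K 0 ↔ ∀ z ∈ K, inner ℝ y z ≤ 1 := by
  simp [polarAt]

namespace IsSymmConvexBody

theorem zero_mem_interior (hK : IsSymmConvexBody K) :
    (0 : EuclideanSpace ℝ (Fin n)) ∈ interior K := by
  obtain ⟨p, hp⟩ := hK.nonempty_interior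
  have h := hK.convex.combo_interior_self_mem_interior hp
    (hK.neg_mem p (interior_subset hp)) (a := 1 / 2) (b := 1 / 2) (by norm_num) (by norm_num)
    (by norm_num)
  simpa using h

theorem zero_mem (hK : IsSymmConvexBody K) : (0 : EuclideanSpace ℝ (Fin n)) ∈ K :=
  interior_subset hK.zero_mem_interior

theorem exists_ball_subset (hK : IsSymmConvexBody K) : ∃ r > 0, Metric.closedBall 0 r ⊆ K :=
  Metric.nhds_basis_closedBall.mem_iff.1 (mem_interior_iff_mem_nhds.1 hK.zero_mem_interior)

theorem exists_norm_le (hK : IsSymmConvexBody K) : ∃ R > 0, ∀ z ∈ K, ‖z‖ ≤ R :=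
  hK.isCompact.isBounded.exists_pos_norm_le

theorem neg_eq (hK : IsSymmConvexBody K) : -K = K := by
  ext z
  exact ⟨fun h => by simpa using hK.neg_mem _ h, fun h => hK.neg_mem _ h⟩

theorem measurableSet (hK : IsSymmConvexBody K) : MeasurableSet K :=
  hK.isCompact.measurableSet

theorem volume_ne_top (hK : IsSymmConvexBody K) : volume K ≠ ⊤ :=
  hK.isCompact.measure_lt_top.ne

theorem volume_real_pos (hK : IsSymmConvexBody K) : 0 < volume.real K :=
  ENNReal.toReal_pos (Measure.measure_pos_of_nonempty_interior _ hK.nonempty_interior).ne'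
    hK.volume_ne_top

protected theorem polar (hK : IsSymmConvexBody K) : IsSymmConvexBody (polarAt K 0) := by
  obtain ⟨r, hr, hrK⟩ := hK.exists_ball_subset
  obtain ⟨R, hR, hKR⟩ := hK.exists_norm_le
  refine ⟨?_, ?_, ?_, ?_⟩
  · intro y hy z hz a b ha hb hab
    rw [mem_polarAt_zero] at *
    intro w hw
    rw [inner_add_left, real_inner_smul_left, real_inner_smul_left]
    nlinarith [hy w hw, hz w hw]
  · refine Metric.isCompact_of_isClosed_isBounded ?_ ?_
    · simp only [polarAt, Set.ofPred_forall]
      exact isClosed_biInter fun z _ => isClosed_le (by fun_prop) continuous_const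
    · refine isBounded_iff_forall_norm_le.2 ⟨1 / r, fun y hy => ?_⟩
      rw [mem_polarAt_zero] at hy
      rcases eq_or_ne y 0 with rfl | hy0
      · simpa using hr.le
      have hyn : 0 < ‖y‖ := norm_pos_iff.2 hy0
      have h := hy ((r / ‖y‖) • y) (hrK (by
        simp [norm_smul, abs_of_pos hr, hyn.ne']))
      rw [real_inner_smul_right, real_inner_self_eq_norm_sq] at h
      rw [le_div_iff₀ hr]
      calc ‖y‖ * r = r / ‖y‖ * ‖y‖ ^ 2 := by field_simp
        _ ≤ 1 := h
  · refine ⟨0, mem_interior_iff_mem_nhds.2 (Filter.mem_of_superset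
      (Metric.closedBall_mem_nhds 0 (ε := 1 / R) (by positivity)) fun y hy => ?_)⟩
    rw [mem_polarAt_zero]
    intro z hz
    rw [mem_closedBall_zero_iff] at hy
    calc inner ℝ y z ≤ ‖y‖ * ‖z‖ := real_inner_le_norm _ _
      _ ≤ 1 / R * R := by gcongr; exact hKR z hz
      _ = 1 := by field_simp
  · intro y hy
    rw [mem_polarAt_zero] at *
    intro z hz
    rw [inner_neg_left, ← inner_neg_right]
    exact hy _ (hK.neg_mem z hz)

/-- The bipolar theorem for `K`: a point outside `K` is separated from `K` by a point of the
polar body. -/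
theorem exists_one_lt_inner (hK : IsSymmConvexBody K) {x : EuclideanSpace ℝ (Fin n)}
    (hx : x ∉ K) : ∃ y ∈ polarAt K 0, 1 < inner ℝ y x := by
  obtain ⟨f, u, hfK, hfx⟩ := geometric_hahn_banach_closed_point hK.convex hK.isCompact.isClosed hx
  have hu : 0 < u := by simpa using hfK 0 hK.zero_mem
  set w := (InnerProductSpace.toDual ℝ (EuclideanSpace ℝ (Fin n))).symm f with hw
  have hfw : ∀ z, inner ℝ w z = f z := fun z => by
    rw [hw, InnerProductSpace.toDual_symm_apply]
  refine ⟨u⁻¹ • w, ?_, ?_⟩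
  · rw [mem_polarAt_zero]
    intro z hz
    rw [real_inner_smul_left, hfw, inv_mul_le_iff₀ hu, mul_one]
    exact (hfK z hz).le
  · rw [real_inner_smul_left, hfw, lt_inv_mul_iff₀ hu, mul_one]
    exact hfx

end IsSymmConvexBody

theorem volume_inner_eq_zero {x : EuclideanSpace ℝ (Fin n)} (hx : x ≠ 0) (c : ℝ) :
    volume {y : EuclideanSpace ℝ (Fin n) | inner ℝ y x = c} = 0 := by
  have hxx : inner ℝ x x ≠ 0 := inner_self_ne_zero.2 hx
  have h0 : volume ((ℝ ∙ x)ᗮ : Set (EuclideanSpace ℝ (Fin n))) = 0 := by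
    refine Measure.addHaar_submodule _ _ fun h => hx ?_
    have : x ∈ (ℝ ∙ x)ᗮ := h ▸ Submodule.mem_top
    rw [Submodule.mem_orthogonal_singleton_iff_inner_left] at this
    exact inner_self_eq_zero.1 this
  rw [← measure_preimage_add_right volume (-((c / inner ℝ x x) • x))] at h0
  convert h0 using 2
  ext y
  simp only [Set.mem_ofPred_eq, Set.mem_preimage, SetLike.mem_coe,
    Submodule.mem_orthogonal_singleton_iff_inner_left, inner_add_left, inner_neg_left,
    real_inner_smul_left,     div_mul_cancel₀ _ hxx, add_neg_eq_zero]

/-- The projective map `y ↦ y / (1 - ⟨y, x⟩)`, which carries the polar body with respect to the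
origin to the polar body with respect to `x`. -/
noncomputable def polarShift (x y : EuclideanSpace ℝ (Fin n)) : EuclideanSpace ℝ (Fin n) :=
  (1 - inner ℝ y x)⁻¹ • y

theorem polarShift_injOn (x : EuclideanSpace ℝ (Fin n)) :
    Set.InjOn (polarShift x) {y | inner ℝ y x < 1} := by
  intro y hy z hz h
  simp only [Set.mem_ofPred_eq] at hy hz
  have hy' : 1 - inner ℝ y x ≠ 0 := by linarith
  have hz' : 1 - inner ℝ z x ≠ 0 := by linarith
  have h2 := congrArg (fun w => inner ℝ w x) h
  simp only [polarShift, real_inner_smul_left] at h2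
  have h3 : inner ℝ y x = inner ℝ z x := by
    field_simp at h2
    linarith
  simp only [polarShift, h3] at h
  exact smul_right_injective _ (inv_ne_zero hz') h

theorem polarShift_image (hK : IsSymmConvexBody K) {x : EuclideanSpace ℝ (Fin n)} (hx : x ∈ K) :
    polarShift x '' (polarAt K 0 ∩ {y | inner ℝ y x < 1}) = polarAt K x := by
  ext w
  constructor
  · rintro ⟨y, ⟨hy, hyx⟩, rfl⟩ z hz
    rw [mem_polarAt_zero] at hy
    simp only [Set.mem_ofPred_eq] at hyx
    rw [polarShift, real_inner_smul_left, inner_sub_right, inv_mul_le_iff₀ (by linarith)]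
    linarith [hy z hz]
  · intro hw
    have hw' : ∀ z ∈ K, inner ℝ w z ≤ 1 + inner ℝ w x := fun z hz => by
      have := hw z hz
      rw [inner_sub_right] at this
      linarith
    have hpos : 0 < 1 + inner ℝ w x := by
      have h0 : 0 ≤ 1 + inner ℝ w x := by simpa using hw' 0 hK.zero_mem
      refine lt_of_le_of_ne h0 fun he => ?_
      -- if `1 + ⟨w, x⟩ = 0`, then `⟨w, ·⟩ ≤ 0` on `K`, although `-x ∈ K` and `⟨w, -x⟩ = 1`
      have := hw' (-x) (hK.neg_mem x hx)
      rw [inner_neg_right] at this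
      linarith
    have h1 : inner ℝ ((1 + inner ℝ w x)⁻¹ • w) x = 1 - (1 + inner ℝ w x)⁻¹ := by
      rw [real_inner_smul_left]
      field_simp
      ring
    refine ⟨(1 + inner ℝ w x)⁻¹ • w, ⟨?_, ?_⟩, ?_⟩
    · rw [mem_polarAt_zero]
      intro z hz
      rw [real_inner_smul_left, inv_mul_le_iff₀ hpos, mul_one]
      exact hw' z hz
    · have := inv_pos.2 hpos
      simp only [Set.mem_ofPred_eq, h1]
      linarith
    · rw [polarShift, h1, sub_sub_cancel, inv_inv, smul_smul, mul_inv_cancel₀ hpos.ne', one_smul]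

theorem hasFDerivAt_polarShift (x : EuclideanSpace ℝ (Fin n)) {y : EuclideanSpace ℝ (Fin n)}
    (hy : inner ℝ y x < 1) :
    HasFDerivAt (polarShift x) ((1 - inner ℝ y x)⁻¹ • ContinuousLinearMap.id ℝ _ +
      (((1 - inner ℝ y x)⁻¹ ^ 2) • innerSL ℝ x).smulRight y) y := by
  have h1 : HasFDerivAt (fun y : EuclideanSpace ℝ (Fin n) => 1 - inner ℝ y x) (-innerSL ℝ x) y := by
    have h := (innerSL ℝ x).hasFDerivAt (x := y)
    have h' := h.const_sub 1
    refine h'.congr_of_eventuallyEq (Filter.Eventually.of_forall fun z => ?_)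
    simp [real_inner_comm]
  have h2 := (hasDerivAt_inv (by linarith : 1 - inner ℝ y x ≠ 0)).comp_hasFDerivAt y h1
  have h3 := h2.smul (hasFDerivAt_id y)
  refine h3.congr_fderiv ?_
  ext z
  simp

theorem det_smul_id_add_smulRight (c : ℝ) (hc : c ≠ 0)
    (f : EuclideanSpace ℝ (Fin n) →L[ℝ] ℝ) (v : EuclideanSpace ℝ (Fin n)) :
    (c • ContinuousLinearMap.id ℝ (EuclideanSpace ℝ (Fin n)) + f.smulRight v).det =
      c ^ n * (1 + c⁻¹ * f v) := by
  have e : ((c • ContinuousLinearMap.id ℝ (EuclideanSpace ℝ (Fin n)) + f.smulRight v :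
      EuclideanSpace ℝ (Fin n) →L[ℝ] EuclideanSpace ℝ (Fin n)) :
        EuclideanSpace ℝ (Fin n) →ₗ[ℝ] EuclideanSpace ℝ (Fin n)) =
      c • LinearMap.transvection (f : EuclideanSpace ℝ (Fin n) →ₗ[ℝ] ℝ) (c⁻¹ • v) := by
    ext z
    simp [LinearMap.transvection, smul_smul, hc, mul_comm]
  rw [ContinuousLinearMap.det, e, LinearMap.det_smul, LinearMap.transvection.det]
  simp

/-- The change of variables formula for `polarShift`. It holds for every `x ∈ K`, with the value `∞`
if the right-hand side diverges, since the hyperplane `⟨y, x⟩ = 1` is a null set. -/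
theorem volume_polarAt (hK : IsSymmConvexBody K) {x : EuclideanSpace ℝ (Fin n)}
    (hx : x ∈ K) :
    volume (polarAt K x) =
      ∫⁻ y in polarAt K 0, (ENNReal.ofReal (1 - inner ℝ y x))⁻¹ ^ (n + 1) := by
  have hLm := hK.polar.measurableSet
  have hSm : MeasurableSet {y : EuclideanSpace ℝ (Fin n) | inner ℝ y x < 1} :=
    measurableSet_lt (by fun_prop) measurable_const
  have hae : (polarAt K 0 ∩ {y | inner ℝ y x < 1} : Set (EuclideanSpace ℝ (Fin n)))
      =ᵐ[volume] polarAt K 0 := by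
    refine (LE.le.eventuallyLE Set.inter_subset_left).antisymm (ae_le_set.2 ?_)
    refine measure_mono_null (t := {y | inner ℝ y x = 1}) ?_ ?_
    · rintro y ⟨hy, hy'⟩
      refine le_antisymm (mem_polarAt_zero.1 hy x hx) ?_
      by_contra h
      exact hy' ⟨hy, lt_of_not_ge h⟩
    · rcases eq_or_ne x 0 with rfl | hx0
      · simp only [inner_zero_right, zero_ne_one, Set.ofPred_false, measure_empty]
      · exact volume_inner_eq_zero hx0 1
  rw [← setLIntegral_congr hae, ← polarShift_image hK hx,
    ← lintegral_abs_det_fderiv_eq_addHaar_image volume (hLm.inter hSm)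
      (fun y hy => (hasFDerivAt_polarShift x hy.2).hasFDerivWithinAt)
      ((polarShift_injOn x).mono Set.inter_subset_right)]
  refine setLIntegral_congr_fun (hLm.inter hSm) fun y hy => ?_
  have h1 : 0 < 1 - inner ℝ y x := sub_pos.2 hy.2
  rw [det_smul_id_add_smulRight _ (inv_ne_zero h1.ne'), ← ENNReal.ofReal_inv_of_pos h1,
    ← ENNReal.ofReal_pow (by positivity)]
  have e : (1 - inner ℝ y x)⁻¹ ^ n * (1 + ((1 - inner ℝ y x)⁻¹)⁻¹ *
      (((1 - inner ℝ y x)⁻¹ ^ 2) • innerSL ℝ x) y) = (1 - inner ℝ y x)⁻¹ ^ (n + 1) := by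
    rw [pow_succ]
    congr 1
    simp only [smul_apply, innerSL_apply_apply, smul_eq_mul,
      real_inner_comm y x]
    field_simp
    ring
  rw [e, abs_of_pos (by positivity)]

end PolarBody

/-! ### The even part of the kernel and the cone profile -/

/-- For `A = (1 - r)⁻¹` and `B = (1 + r)⁻¹`, both `(A ^ m - B ^ m) / r` and `A ^ m + B ^ m`
increase with `r ∈ [0, 1)`; the former is at least its limit `2 m` at `0`, the latter at least its
second-order Taylor polynomial there. With `q = (1 - r ^ 2)⁻¹` they satisfy the recursion
`D (m + 1) = q (D m + S m)`, `S (m + 1) = q (S m + r ^ 2 D m)`, which makes these properties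
evident. -/
theorem exists_monotoneOn_inv_pow_sub_and_add (m : ℕ) :
    ∃ D S : ℝ → ℝ, MonotoneOn D (Set.Ico 0 1) ∧ MonotoneOn S (Set.Ico 0 1) ∧
      ∀ r ∈ Set.Ico (0 : ℝ) 1, (1 - r)⁻¹ ^ m - (1 + r)⁻¹ ^ m = r * D r ∧
        (1 - r)⁻¹ ^ m + (1 + r)⁻¹ ^ m = S r ∧ 2 * (m : ℝ) ≤ D r ∧
        2 + (m : ℝ) * (m + 1) * r ^ 2 ≤ S r := by
  induction m with
  | zero => exact ⟨fun _ => 0, fun _ => 2, monotoneOn_const, monotoneOn_const, fun r _ => by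
      norm_num⟩
  | succ m ih =>
    obtain ⟨D, S, hD, hS, h⟩ := ih
    have hq : MonotoneOn (fun r : ℝ => (1 - r ^ 2)⁻¹) (Set.Ico 0 1) := by
      intro r hr s hs hrs
      have h1 := hr.1
      have h2 := hs.2
      have : r ^ 2 ≤ s ^ 2 := by gcongr
      have : s ^ 2 < 1 := by nlinarith
      exact inv_anti₀ (by linarith) (by linarith)
    have hq1 : ∀ r ∈ Set.Ico (0 : ℝ) 1, 1 + r ^ 2 ≤ (1 - r ^ 2)⁻¹ := by
      intro r hr
      have h1 := hr.1
      have h2 := hr.2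
      have : r ^ 2 < 1 := by nlinarith
      rw [le_inv_comm₀ (by positivity) (by linarith), ← one_div, le_div_iff₀ (by positivity)]
      nlinarith [sq_nonneg (r ^ 2)]
    have hq0 : ∀ r ∈ Set.Ico (0 : ℝ) 1, 0 ≤ (1 - r ^ 2)⁻¹ := fun r hr => by
      nlinarith [hq1 r hr]
    have hD0 : ∀ r ∈ Set.Ico (0 : ℝ) 1, 0 ≤ D r := fun r hr => by
      have := (h r hr).2.2.1
      have : (0 : ℝ) ≤ m := by positivity
      linarith
    have hS0 : ∀ r ∈ Set.Ico (0 : ℝ) 1, 0 ≤ S r := fun r hr => by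
      have := (h r hr).2.2.2
      have : (0 : ℝ) ≤ m * (m + 1) * r ^ 2 := by positivity
      linarith
    refine ⟨fun r => (1 - r ^ 2)⁻¹ * (D r + S r), fun r => (1 - r ^ 2)⁻¹ * (S r + r ^ 2 * D r),
      hq.mul (hD.add hS) hq0 (fun r hr => add_nonneg (hD0 r hr) (hS0 r hr)),
      hq.mul (hS.add (MonotoneOn.mul (fun r hr s hs hrs => by
        have := hr.1
        gcongr) hD (fun r _ => sq_nonneg r) hD0)) hq0
        (fun r hr => add_nonneg (hS0 r hr) (mul_nonneg (sq_nonneg r) (hD0 r hr))), ?_⟩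
    intro r hr
    obtain ⟨h1, h2, h3, h4⟩ := h r hr
    have hr0 := hr.1
    have hr1 := hr.2
    have hA : (1 - r)⁻¹ = (1 - r ^ 2)⁻¹ * (1 + r) := by
      have : 1 - r ≠ 0 := by linarith
      have : 1 + r ≠ 0 := by linarith
      rw [show 1 - r ^ 2 = (1 - r) * (1 + r) by ring]
      field_simp
    have hB : (1 + r)⁻¹ = (1 - r ^ 2)⁻¹ * (1 - r) := by
      have : 1 - r ≠ 0 := by linarith
      have : 1 + r ≠ 0 := by linarith
      rw [show 1 - r ^ 2 = (1 - r) * (1 + r) by ring]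
      field_simp
    have hq1r := hq1 r hr
    have hm : (0 : ℝ) ≤ m := by positivity
    refine ⟨?_, ?_, ?_, ?_⟩
    · beta_reduce
      rw [pow_succ, pow_succ, ← h2]
      calc _ = (1 - r)⁻¹ ^ m * ((1 - r ^ 2)⁻¹ * (1 + r))
            - (1 + r)⁻¹ ^ m * ((1 - r ^ 2)⁻¹ * (1 - r)) := by rw [← hA, ← hB]
        _ = (1 - r ^ 2)⁻¹ * (((1 - r)⁻¹ ^ m - (1 + r)⁻¹ ^ m)
            + r * ((1 - r)⁻¹ ^ m + (1 + r)⁻¹ ^ m)) := by ring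
        _ = _ := by rw [h1]; ring
    · beta_reduce
      rw [pow_succ, pow_succ, ← h2]
      calc _ = (1 - r)⁻¹ ^ m * ((1 - r ^ 2)⁻¹ * (1 + r))
            + (1 + r)⁻¹ ^ m * ((1 - r ^ 2)⁻¹ * (1 - r)) := by rw [← hA, ← hB]
        _ = (1 - r ^ 2)⁻¹ * (((1 - r)⁻¹ ^ m + (1 + r)⁻¹ ^ m)
            + r * ((1 - r)⁻¹ ^ m - (1 + r)⁻¹ ^ m)) := by ring
        _ = _ := by rw [h1]; ring
    · have : 2 * (m : ℝ) + 2 ≤ D r + S r := by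
        have : 0 ≤ (m : ℝ) * (m + 1) * r ^ 2 := by positivity
        linarith
      push_cast
      nlinarith [sq_nonneg r]
    · have h5 : r ^ 2 * (2 * m) ≤ r ^ 2 * D r := by gcongr
      have h6 : 2 + ((m : ℝ) * (m + 1) + 2 * m) * r ^ 2 ≤ S r + r ^ 2 * D r := by linarith
      have h7 : (0 : ℝ) ≤ ((m : ℝ) * (m + 1) + 2 * m) * (r ^ 2 * r ^ 2) := by positivity
      push_cast
      calc 2 + ((m : ℝ) + 1) * (m + 1 + 1) * r ^ 2
          ≤ (1 + r ^ 2) * (2 + ((m : ℝ) * (m + 1) + 2 * m) * r ^ 2) := by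
            nlinarith [h7]
        _ ≤ (1 - r ^ 2)⁻¹ * (S r + r ^ 2 * D r) := by
            gcongr
            exact hq0 r hr

theorem quadratic_le_inv_pow_add {m : ℕ} {s : ℝ} (hs : |s| < 1) :
    2 + (m : ℝ) * (m + 1) * s ^ 2 ≤ (1 - s)⁻¹ ^ m + (1 + s)⁻¹ ^ m := by
  obtain ⟨D, S, -, -, h⟩ := exists_monotoneOn_inv_pow_sub_and_add m
  have h' := h |s| ⟨abs_nonneg s, hs⟩
  rw [← h'.2.1, sq_abs] at h'
  rcases abs_choice s with e | e
  · rw [e] at h'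
    exact h'.2.2.2
  · rw [e, sub_neg_eq_add, ← sub_eq_add_neg, add_comm ((1 + s)⁻¹ ^ m)] at h'
    exact h'.2.2.2

/-- The even part of `(1 - s)⁻⁽ⁿ⁺¹⁾` is at least `(1 - s² / 2)⁻ⁿ`: by the arithmetic-geometric mean
inequality it is at least `(1 - s²)^(-(n + 1) / 2)`, and `1 - s² ≤ (1 - s² / 2)²`. -/
theorem inv_pow_le_inv_pow_add {n : ℕ} {s : ℝ} (hs : |s| < 1) :
    2 * (1 - s ^ 2 / 2)⁻¹ ^ n ≤ (1 - s)⁻¹ ^ (n + 1) + (1 + s)⁻¹ ^ (n + 1) := by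
  obtain ⟨h1, h2⟩ := abs_lt.1 hs
  have h3 : s ^ 2 < 1 := (sq_lt_one_iff_abs_lt_one s).2 hs
  have hA : 0 < (1 - s)⁻¹ := inv_pos.2 (by linarith)
  have hB : 0 < (1 + s)⁻¹ := inv_pos.2 (by linarith)
  have hH : 0 < (1 - s ^ 2 / 2)⁻¹ := inv_pos.2 (by linarith)
  have hAB : ((1 - s ^ 2 / 2)⁻¹) ^ 2 ≤ (1 - s)⁻¹ * (1 + s)⁻¹ := by
    rw [inv_pow, ← mul_inv]
    exact inv_anti₀ (by nlinarith) (by nlinarith [sq_nonneg (s ^ 2)])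
  have hAB1 : 1 ≤ (1 - s)⁻¹ * (1 + s)⁻¹ := by
    rw [← mul_inv, one_le_inv₀ (by nlinarith)]
    nlinarith
  have key : ((1 - s ^ 2 / 2)⁻¹ ^ n) ^ 2 ≤ (1 - s)⁻¹ ^ (n + 1) * (1 + s)⁻¹ ^ (n + 1) := by
    calc ((1 - s ^ 2 / 2)⁻¹ ^ n) ^ 2 = (((1 - s ^ 2 / 2)⁻¹) ^ 2) ^ n := by
          rw [← pow_mul, ← pow_mul, mul_comm]
      _ ≤ ((1 - s)⁻¹ * (1 + s)⁻¹) ^ n := by gcongr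
      _ ≤ ((1 - s)⁻¹ * (1 + s)⁻¹) ^ (n + 1) := pow_le_pow_right₀ hAB1 (Nat.le_succ n)
      _ = _ := mul_pow _ _ _
  have hX : 0 < (1 - s)⁻¹ ^ (n + 1) := by positivity
  have hY : 0 < (1 + s)⁻¹ ^ (n + 1) := by positivity
  refine le_of_sq_le_sq ?_ (by positivity)
  nlinarith [sq_nonneg ((1 - s)⁻¹ ^ (n + 1) - (1 + s)⁻¹ ^ (n + 1))]

/-- The convex function `q ↦ (1 - q / 2)⁻ⁿ` lies above its tangent line at `p`. -/
theorem tangent_le_inv_pow {n : ℕ} {p q : ℝ} (hp : p < 2) (hq : q < 2) :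
    (1 - p / 2)⁻¹ ^ n * (1 - n * ((1 - q / 2) / (1 - p / 2) - 1)) ≤ (1 - q / 2)⁻¹ ^ n := by
  have hP : 0 < 1 - p / 2 := by linarith
  have hQ : 0 < 1 - q / 2 := by linarith
  set r := (1 - q / 2) / (1 - p / 2) with hr
  have hr0 : 0 < r := div_pos hQ hP
  have h1 : 1 - r ≤ r⁻¹ - 1 := by
    have : r⁻¹ * r = 1 := inv_mul_cancel₀ hr0.ne'
    nlinarith [sq_nonneg (r - 1), inv_pos.2 hr0]
  have h2 : 1 - n * (r - 1) ≤ r⁻¹ ^ n := by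
    have h := one_add_mul_le_pow (a := r⁻¹ - 1) (by linarith [inv_pos.2 hr0]) n
    rw [add_sub_cancel] at h
    refine le_trans ?_ h
    have : (n : ℝ) * (1 - r) ≤ n * (r⁻¹ - 1) := by gcongr
    linarith
  calc _ ≤ (1 - p / 2)⁻¹ ^ n * r⁻¹ ^ n := by gcongr
    _ = _ := by
      rw [← mul_pow, hr, inv_div, ← mul_div_assoc, inv_mul_cancel₀ hP.ne', one_div]

/-- The first moment of the cone profile `(1 - r / α)ⁿ`. -/
theorem integral_mul_one_sub_div_pow (n : ℕ) {α : ℝ} (hα : 0 < α) :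
    ∫ r in (0 : ℝ)..α, r * (1 - r / α) ^ n = α ^ 2 / ((n + 1) * (n + 2)) := by
  have hd : ∀ r ∈ Set.uIcc 0 α, HasDerivAt (fun r : ℝ =>
      α ^ 2 * ((1 - r / α) ^ (n + 2) / (n + 2) - (1 - r / α) ^ (n + 1) / (n + 1)))
      (r * (1 - r / α) ^ n) r := by
    intro r _
    have h0 : HasDerivAt (fun r : ℝ => 1 - r / α) (-(1 / α)) r :=
      ((hasDerivAt_id r).div_const α).const_sub 1
    have h := ((((h0.pow (n + 2)).div_const ((n : ℝ) + 2)).sub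
      ((h0.pow (n + 1)).div_const ((n : ℝ) + 1))).const_mul (α ^ 2))
    refine h.congr_deriv ?_
    have : (n : ℝ) + 1 ≠ 0 := by positivity
    have : (n : ℝ) + 2 ≠ 0 := by positivity
    simp only [Nat.add_sub_cancel, show n + 2 - 1 = n + 1 from rfl]
    push_cast
    obtain ⟨u, hu⟩ : ∃ u, u = 1 - r / α := ⟨_, rfl⟩
    have hr : r = α * (1 - u) := by
      rw [hu]
      field_simp
      ring
    rw [← hu, hr]
    field_simp
    ring
  rw [intervalIntegral.integral_eq_sub_of_hasDerivAt hd
    (Continuous.intervalIntegrable (by fun_prop) _ _)]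
  have : (n : ℝ) + 1 ≠ 0 := by positivity
  have : (n : ℝ) + 2 ≠ 0 := by positivity
  simp only [div_self hα.ne', sub_self, zero_div, sub_zero, one_pow, ne_eq, Nat.add_eq_zero_iff,
    OfNat.ofNat_ne_zero, one_ne_zero, and_false, not_false_eq_true, zero_pow]
  field_simp
  ring

/-- The integrand is the derivative of a multiple of `((1 - r / α) / (1 - c r))ⁿ⁺¹`. -/
theorem integral_inv_pow_mul_one_sub_div_pow (n : ℕ) {α c : ℝ} (hα : 0 < α) (hc : c * α < 1) :
    ∫ r in (0 : ℝ)..α, (n + 1) * (1 - c * r)⁻¹ ^ (n + 2) * (1 - r / α) ^ n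
      = α / (1 - c * α) := by
  have hpos : ∀ r ∈ Set.uIcc 0 α, 0 < 1 - c * r := by
    intro r hr
    rw [Set.uIcc_of_le hα.le] at hr
    rcases le_total 0 c with h | h
    · nlinarith [hr.1, hr.2]
    · nlinarith [hr.1, hr.2]
  have hne : 1 - c * α ≠ 0 := by linarith
  have hd : ∀ r ∈ Set.uIcc 0 α, HasDerivAt (fun r : ℝ =>
      -(α / (1 - c * α)) * ((1 - r / α) * (1 - c * r)⁻¹) ^ (n + 1))
      ((n + 1) * (1 - c * r)⁻¹ ^ (n + 2) * (1 - r / α) ^ n) r := by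
    intro r hr
    have hr0 := (hpos r hr).ne'
    have h0 : HasDerivAt (fun r : ℝ => 1 - r / α) (-(1 / α)) r :=
      ((hasDerivAt_id r).div_const α).const_sub 1
    have h1 : HasDerivAt (fun r : ℝ => 1 - c * r) (-(c * 1)) r :=
      ((hasDerivAt_id r).const_mul c).const_sub 1
    have h := ((h0.mul (h1.inv hr0)).pow (n + 1)).const_mul (-(α / (1 - c * α)))
    refine h.congr_deriv ?_
    simp only [Nat.add_sub_cancel, mul_pow, Pi.mul_apply, Pi.inv_apply]
    push_cast
    have e : -(1 / α) * (1 - c * r)⁻¹ + (1 - r / α) * (-(-(c * 1)) / (1 - c * r) ^ 2)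
        = -((1 - c * α) / α) * (1 - c * r)⁻¹ ^ 2 := by
      field_simp
      ring
    rw [e]
    generalize (1 - c * r)⁻¹ = w
    generalize 1 - r / α = u
    have h1 : α / (1 - c * α) * ((1 - c * α) / α) = 1 := by
      rw [div_mul_div_cancel₀ hne, div_self hα.ne']
    linear_combination ((n + 1) * u ^ n * w ^ (n + 2)) * h1
  rw [intervalIntegral.integral_eq_sub_of_hasDerivAt hd]
  · simp [div_self hα.ne']
  · refine ContinuousOn.intervalIntegrable ?_
    refine ContinuousOn.mul (ContinuousOn.mul continuousOn_const (ContinuousOn.pow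
      (ContinuousOn.inv₀ (by fun_prop) fun r hr => (hpos r hr).ne') _)) (by fun_prop)

/-! ### Comparison of distribution functions with the cone profile -/

theorem Antitone.intervalIntegrable_mul {N : ℝ → ℝ} (hNa : Antitone N) {g : ℝ → ℝ} {a b : ℝ}
    (hg : ContinuousOn g (Set.uIcc a b)) :
    IntervalIntegrable (fun r => g r * N r) volume a b :=
  (hNa.intervalIntegrable).continuousOn_mul hg

/-- The inequality `(1 - θ) N(0)^(1/n) + θ N(r)^(1/n) ≤ N(θ r)^(1/n)`, valid as long as
`N(r) > 0`: the distribution function `N` is `1/n`-concave along segments that start at `0`. -/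
def ConcaveFromZero (n : ℕ) (N : ℝ → ℝ) : Prop :=
  ∀ θ ∈ Set.Ioo (0 : ℝ) 1, ∀ r > 0, 0 < N r →
    (1 - θ) * N 0 ^ (1 / (n : ℝ)) + θ * N r ^ (1 / (n : ℝ)) ≤ N (θ * r) ^ (1 / (n : ℝ))

namespace ConcaveFromZero

variable {n : ℕ} {N : ℝ → ℝ}

/-- If `N` lies above `cⁿ N(0)` at `a`, then on `(0, a)` it lies above the `n`-th power of the
linear function that interpolates between the `n`-th roots. -/
theorem le_apply (hN : ConcaveFromZero n N) (hn : n ≠ 0) (hN0 : ∀ r, 0 ≤ N r) {a r : ℝ}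
    (ha : 0 < a) (hr : r ∈ Set.Ioo 0 a) (hNa : 0 < N a) {c : ℝ} (hc : 0 ≤ c)
    (hcN : c ^ n * N 0 ≤ N a) :
    (1 - r / a + r / a * c) ^ n * N 0 ≤ N r := by
  have hra : r / a < 1 := (div_lt_one ha).2 hr.2
  have hra0 : 0 < r / a := div_pos hr.1 ha
  have h := hN (r / a) ⟨hra0, hra⟩ a ha hNa
  rw [div_mul_cancel₀ _ ha.ne'] at h
  have hp : ∀ x : ℝ, 0 ≤ x → (x ^ (1 / (n : ℝ))) ^ n = x := fun x hx => by
    rw [one_div, Real.rpow_inv_natCast_pow hx hn]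
  have h0 : 0 ≤ N 0 ^ (1 / (n : ℝ)) := Real.rpow_nonneg (hN0 0) _
  have h1 : c * N 0 ^ (1 / (n : ℝ)) ≤ N a ^ (1 / (n : ℝ)) := by
    refine le_of_pow_le_pow_left₀ hn (Real.rpow_nonneg (hN0 a) _) ?_
    rwa [mul_pow, hp _ (hN0 0), hp _ (hN0 a)]
  have h2 : (1 - r / a + r / a * c) * N 0 ^ (1 / (n : ℝ)) ≤ N r ^ (1 / (n : ℝ)) := by
    refine le_trans ?_ h
    nlinarith
  calc (1 - r / a + r / a * c) ^ n * N 0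
      = ((1 - r / a + r / a * c) * N 0 ^ (1 / (n : ℝ))) ^ n := by rw [mul_pow, hp _ (hN0 0)]
    _ ≤ (N r ^ (1 / (n : ℝ))) ^ n := by
      have : 0 ≤ 1 - r / a := by linarith
      gcongr
    _ = N r := hp _ (hN0 r)

/-- If `N` lies above the cone profile `N(0) (1 - r / α)ⁿ` somewhere in its support, then it does
so at all earlier points. -/
theorem cone_le_of_cone_le (hN : ConcaveFromZero n N) (hn : n ≠ 0) (hN0 : ∀ r, 0 ≤ N r)
    {α a r : ℝ} (ha : a ∈ Set.Ioc 0 α) (hr : r ∈ Set.Ioo 0 a) (hNa : 0 < N a)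
    (h : N 0 * (1 - a / α) ^ n ≤ N a) : N 0 * (1 - r / α) ^ n ≤ N r := by
  have hα : 0 < α := ha.1.trans_le ha.2
  have h' := hN.le_apply hn hN0 ha.1 hr hNa (c := 1 - a / α)
    (by linarith [(div_le_one hα).2 ha.2]) (by rwa [mul_comm])
  have e : 1 - r / a + r / a * (1 - a / α) = 1 - r / α := by
    have := ha.1.ne'
    field_simp
    ring
  rwa [e, mul_comm] at h'

/-- The first moment of `N` controls its support: if `N` were positive at some `a > α`, then it
would lie above the cone profile that vanishes at `a`, whose first moment is too large. -/
theorem eq_zero_of_lt (hN : ConcaveFromZero n N) (hn : n ≠ 0) (hN0 : ∀ r, 0 ≤ N r)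
    (hNa : Antitone N) (hN00 : 0 < N 0) {α R : ℝ} (hα : 0 < α)
    (hR : ∀ r > R, N r = 0)
    (hmom : ∫ r in (0 : ℝ)..R, r * N r = N 0 * (α ^ 2 / ((n + 1) * (n + 2)))) {a : ℝ}
    (ha : α < a) : N a = 0 := by
  by_contra hne
  have hNapos : 0 < N a := lt_of_le_of_ne (hN0 a) (Ne.symm hne)
  have ha0 : 0 < a := hα.trans ha
  have haR : a ≤ R := by
    by_contra h
    exact hne (hR a (not_le.1 h))
  have h1 : ∫ r in (0 : ℝ)..a, N 0 * (r * (1 - r / a) ^ n) ≤ ∫ r in (0 : ℝ)..a, r * N r := by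
    refine intervalIntegral.integral_mono_on_of_le_Ioo ha0.le
      (Continuous.intervalIntegrable (by fun_prop) _ _)
      (hNa.intervalIntegrable_mul continuousOn_id) fun r hr => ?_
    have h := hN.le_apply hn hN0 ha0 hr hNapos (c := 0) le_rfl (by simp [hn, hN0 a])
    rw [mul_zero, add_zero] at h
    nlinarith [hr.1]
  have h2 : ∫ r in (0 : ℝ)..a, r * N r ≤ ∫ r in (0 : ℝ)..R, r * N r := by
    refine intervalIntegral.integral_mono_interval le_rfl ha0.le haR ?_
      (hNa.intervalIntegrable_mul continuousOn_id)
    filter_upwards [ae_restrict_mem measurableSet_Ioc] with r hr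
    exact mul_nonneg hr.1.le (hN0 r)
  rw [intervalIntegral.integral_const_mul, integral_mul_one_sub_div_pow n ha0] at h1
  have h3 := h1.trans (h2.trans_eq hmom)
  have h4 := le_of_mul_le_mul_left h3 hN00
  rw [div_le_div_iff_of_pos_right (by positivity)] at h4
  nlinarith

/-- Comparison with the cone profile `G r = N(0) (1 - r / α)ⁿ`. As `N` and `G` have the same first
moment and `N - G` changes sign at most once, from `+` to `-`, increasing weights `ψ` put more mass
on `G`. -/
theorem integral_le (hN : ConcaveFromZero n N) (hn : n ≠ 0) (hN0 : ∀ r, 0 ≤ N r)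
    (hNa : Antitone N) {α : ℝ} (hα : 0 < α)
    (hmom : ∫ r in (0 : ℝ)..α, r * N r = N 0 * (α ^ 2 / ((n + 1) * (n + 2))))
    {g ψ : ℝ → ℝ} (hg : ContinuousOn g (Set.Icc 0 α)) (hψ : MonotoneOn ψ (Set.Icc 0 α))
    (hgψ : ∀ r ∈ Set.Icc 0 α, g r = r * ψ r) :
    ∫ r in (0 : ℝ)..α, g r * N r ≤ N 0 * ∫ r in (0 : ℝ)..α, g r * (1 - r / α) ^ n := by
  set P : Set ℝ := {a | a ∈ Set.Ioc 0 α ∧ 0 < N a ∧ N 0 * (1 - a / α) ^ n ≤ N a} with hP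
  -- the point at which `N - G` changes sign
  set b := sSup (insert 0 P) with hb
  have hbdd : BddAbove (insert 0 P) := ⟨α, by
    rintro a (rfl | ha)
    · exact hα.le
    · exact ha.1.2⟩
  have hb0 : 0 ≤ b := le_csSup hbdd (Set.mem_insert _ _)
  have hbα : b ≤ α := csSup_le (Set.insert_nonempty _ _) (by
    rintro a (rfl | ha)
    · exact hα.le
    · exact ha.1.2)
  have hlow : ∀ r ∈ Set.Ioo 0 α, r < b → N 0 * (1 - r / α) ^ n ≤ N r := by
    intro r hr hrb
    obtain ⟨a, ha, hra⟩ := exists_lt_of_lt_csSup (Set.insert_nonempty _ _) hrb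
    rcases ha with rfl | ha
    · exact absurd hra hr.1.not_gt
    · exact hN.cone_le_of_cone_le hn hN0 ha.1 ⟨hr.1, hra⟩ ha.2.1 ha.2.2
  have hhigh : ∀ r ∈ Set.Ioo 0 α, b < r → N r ≤ N 0 * (1 - r / α) ^ n := by
    intro r hr hbr
    have hG : 0 ≤ N 0 * (1 - r / α) ^ n := by
      have := (div_le_one hα).2 hr.2.le
      exact mul_nonneg (hN0 0) (pow_nonneg (by linarith) _)
    by_contra hcon
    have : r ∈ P := ⟨⟨hr.1, hr.2.le⟩, hG.trans_lt (not_le.1 hcon), (not_le.1 hcon).le⟩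
    exact absurd (le_csSup hbdd (Set.mem_insert_of_mem _ this)) hbr.not_ge
  have hu : Set.uIcc 0 α = Set.Icc 0 α := Set.uIcc_of_le hα.le
  have hI1 : IntervalIntegrable (fun r => g r * N r) volume 0 α :=
    hNa.intervalIntegrable_mul (hu ▸ hg)
  have hI2 : IntervalIntegrable (fun r => g r * (1 - r / α) ^ n) volume 0 α :=
    ContinuousOn.intervalIntegrable (hu ▸ hg.mul (by fun_prop))
  have hI3 : IntervalIntegrable (fun r => r * N r) volume 0 α :=
    hNa.intervalIntegrable_mul continuousOn_id
  have hI4 : IntervalIntegrable (fun r => r * (1 - r / α) ^ n) volume 0 α :=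
    Continuous.intervalIntegrable (by fun_prop) _ _
  have key : ∫ r in (0 : ℝ)..α, (g r * N r - N 0 * (g r * (1 - r / α) ^ n)) ≤
      ∫ r in (0 : ℝ)..α, ψ b * (r * N r - N 0 * (r * (1 - r / α) ^ n)) := by
    refine intervalIntegral.integral_mono_on_of_le_Ioo hα.le (hI1.sub (hI2.const_mul _))
      ((hI3.sub (hI4.const_mul _)).const_mul _) fun r hr => ?_
    have hrI : r ∈ Set.Icc 0 α := ⟨hr.1.le, hr.2.le⟩
    have hbI : b ∈ Set.Icc 0 α := ⟨hb0, hbα⟩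
    rw [hgψ r hrI]
    have h : (ψ r - ψ b) * (N r - N 0 * (1 - r / α) ^ n) ≤ 0 := by
      rcases lt_trichotomy r b with h | h | h
      · exact mul_nonpos_of_nonpos_of_nonneg (sub_nonpos.2 (hψ hrI hbI h.le))
          (sub_nonneg.2 (hlow r hr h))
      · simp [h]
      · exact mul_nonpos_of_nonneg_of_nonpos (sub_nonneg.2 (hψ hbI hrI h.le))
          (sub_nonpos.2 (hhigh r hr h))
    nlinarith [mul_nonpos_of_nonneg_of_nonpos hr.1.le h]
  rw [intervalIntegral.integral_const_mul, intervalIntegral.integral_sub hI1 (hI2.const_mul _),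
    intervalIntegral.integral_sub hI3 (hI4.const_mul _), intervalIntegral.integral_const_mul,
    intervalIntegral.integral_const_mul, hmom, integral_mul_one_sub_div_pow n hα, sub_self,
    mul_zero] at key
  linarith

end ConcaveFromZero

/-! ### Moments of linear functionals on a symmetric convex body -/

section Moments

variable {n : ℕ} {K L : Set (EuclideanSpace ℝ (Fin n))} {x : EuclideanSpace ℝ (Fin n)}

/-- The volume of the part of `L` outside the slab `|⟨y, x⟩| ≤ r`. -/
noncomputable def slabTail (L : Set (EuclideanSpace ℝ (Fin n))) (x : EuclideanSpace ℝ (Fin n))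
    (r : ℝ) : ℝ :=
  volume.real (L ∩ {y | r < |inner ℝ y x|})

/-- The square of the norm whose unit ball is the Binet ellipsoid of `L`. -/
noncomputable def binetForm (L : Set (EuclideanSpace ℝ (Fin n))) (x : EuclideanSpace ℝ (Fin n)) :
    ℝ :=
  1 / volume.real L * ∫ y in L, (inner ℝ y x) ^ 2

theorem slabTail_nonneg (r : ℝ) : 0 ≤ slabTail L x r := measureReal_nonneg

theorem binetForm_nonneg (x : EuclideanSpace ℝ (Fin n)) : 0 ≤ binetForm L x :=
  mul_nonneg (by positivity) (integral_nonneg fun y => sq_nonneg _)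

theorem measurableSet_lt_abs_inner (r : ℝ) :
    MeasurableSet {y : EuclideanSpace ℝ (Fin n) | r < |inner ℝ y x|} :=
  (isOpen_lt continuous_const (by fun_prop)).measurableSet

theorem measurableSet_lt_inner (r : ℝ) :
    MeasurableSet {y : EuclideanSpace ℝ (Fin n) | r < inner ℝ y x} :=
  (isOpen_lt continuous_const (by fun_prop)).measurableSet

theorem slabTail_zero (hx : x ≠ 0) :
    slabTail L x 0 = volume.real L := by
  refine measureReal_congr (Filter.EventuallyLE.antisymm
    (LE.le.eventuallyLE Set.inter_subset_left) (ae_le_set.2 ?_))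
  refine measure_mono_null (t := {y | inner ℝ y x = 0}) ?_ (volume_inner_eq_zero hx 0)
  rintro y ⟨hy, hy'⟩
  by_contra h
  exact hy' ⟨hy, abs_pos.2 h⟩

theorem two_mul_ofReal (r : ℝ) : 2 * ENNReal.ofReal r = ENNReal.ofReal (2 * r) := by
  rw [ENNReal.ofReal_mul zero_le_two, ENNReal.ofReal_ofNat]

namespace IsSymmConvexBody

theorem integrableOn (hL : IsSymmConvexBody L) {f : EuclideanSpace ℝ (Fin n) → ℝ}
    (hf : Continuous f) : IntegrableOn f L :=
  hf.continuousOn.integrableOn_compact hL.isCompact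

theorem inter_ne_top (hL : IsSymmConvexBody L) (S : Set (EuclideanSpace ℝ (Fin n))) :
    volume (L ∩ S) ≠ ⊤ :=
  ne_top_of_le_ne_top hL.volume_ne_top (measure_mono Set.inter_subset_left)

theorem integral_inner_sq (hL : IsSymmConvexBody L) (x : EuclideanSpace ℝ (Fin n)) :
    ∫ y in L, (inner ℝ y x) ^ 2 = volume.real L * binetForm L x := by
  rw [binetForm, ← mul_assoc, mul_one_div_cancel hL.volume_real_pos.ne', one_mul]

theorem lintegral_comp_neg (hL : IsSymmConvexBody L) (f : EuclideanSpace ℝ (Fin n) → ℝ≥0∞) :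
    ∫⁻ y in L, f (-y) = ∫⁻ y in L, f y := by
  have hmp := (Measure.measurePreserving_neg (volume : Measure (EuclideanSpace ℝ (Fin n))))
  have h := hmp.setLIntegral_comp_preimage_emb (MeasurableEquiv.neg _).measurableEmbedding f L
  rw [← h]
  congr 2
  exact hL.neg_eq.symm

theorem slabTail_antitone (hL : IsSymmConvexBody L) : Antitone (slabTail L x) := fun _ _ h =>
  measureReal_mono (Set.inter_subset_inter_right _ fun _ hy => lt_of_le_of_lt h hy)
    (hL.inter_ne_top _)

theorem slabTail_eq_two_mul (hL : IsSymmConvexBody L) {r : ℝ} (hr : 0 ≤ r) :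
    slabTail L x r = 2 * volume.real (L ∩ {y | r < inner ℝ y x}) := by
  have hneg : volume.real (L ∩ {y | r < inner ℝ (-y) x}) =
      volume.real (L ∩ {y | r < inner ℝ y x}) := by
    rw [Measure.real, Measure.real, ← Measure.measure_neg]
    congr 2
    ext y
    have : -y ∈ L ↔ y ∈ L := ⟨fun h => by simpa using hL.neg_mem _ h, hL.neg_mem y⟩
    simp [this]
  have hU : L ∩ {y | r < |inner ℝ y x|} =
      (L ∩ {y | r < inner ℝ y x}) ∪ (L ∩ {y | r < inner ℝ (-y) x}) := by
    rw [← Set.inter_union_distrib_left]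
    congr 1
    ext y
    simp [lt_abs, inner_neg_left]
  have hd : Disjoint (L ∩ {y | r < inner ℝ y x}) (L ∩ {y | r < inner ℝ (-y) x}) := by
    refine Set.disjoint_left.2 fun y hy hy' => ?_
    have h1 := hy.2
    have h2 := hy'.2
    simp only [Set.mem_ofPred_eq, inner_neg_left] at h1 h2
    linarith
  have hm : MeasurableSet {y : EuclideanSpace ℝ (Fin n) | r < inner ℝ (-y) x} :=
    (isOpen_lt continuous_const (by fun_prop)).measurableSet
  rw [slabTail, hU, measureReal_union hd (hL.measurableSet.inter hm) (hL.inter_ne_top _)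
    (hL.inter_ne_top _), hneg, two_mul]

theorem concaveFromZero_slabTail (hL : IsSymmConvexBody L) (hn : n ≠ 0) :
    ConcaveFromZero n (slabTail L x) := by
  intro θ hθ r hr hNr
  have hN0 : 0 < slabTail L x 0 := hNr.trans_le (hL.slabTail_antitone hr.le)
  have hθr : 0 ≤ θ * r := mul_nonneg hθ.1.le hr.le
  rw [hL.slabTail_eq_two_mul le_rfl] at hN0 ⊢
  rw [hL.slabTail_eq_two_mul hr.le] at hNr ⊢
  rw [hL.slabTail_eq_two_mul hθr]
  have hm : ∀ c : ℝ, MeasurableSet (L ∩ {y | c < inner ℝ y x}) := fun c =>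
    hL.measurableSet.inter (measurableSet_lt_inner c)
  have key := brunn_minkowski hn (sub_pos.2 hθ.2) hθ.1 (hm 0) (hm r) (hm (θ * r))
    (by linarith) (by linarith) (hL.inter_ne_top _) (by
      rintro a ⟨ha, ha'⟩ b ⟨hb, hb'⟩
      refine ⟨hL.convex ha hb (sub_nonneg.2 hθ.2.le) hθ.1.le (by ring), ?_⟩
      simp only [Set.mem_ofPred_eq, inner_add_left, real_inner_smul_left] at ha' hb' ⊢
      have h1 : 0 < (1 - θ) * inner ℝ a x := mul_pos (sub_pos.2 hθ.2) ha'
      have h2 : θ * r < θ * inner ℝ b x := mul_lt_mul_of_pos_left hb' hθ.1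
      linarith)
  have hsplit : ∀ S : Set (EuclideanSpace ℝ (Fin n)), (2 * volume.real S) ^ (1 / (n : ℝ)) =
      2 ^ (1 / (n : ℝ)) * volume.real S ^ (1 / (n : ℝ)) := fun S =>
    Real.mul_rpow (by norm_num) measureReal_nonneg
  rw [hsplit, hsplit, hsplit]
  have h2 : (0 : ℝ) ≤ 2 ^ (1 / (n : ℝ)) := by positivity
  nlinarith [mul_le_mul_of_nonneg_left key h2]

/-- Layer cake formula for functions of `|⟨y, x⟩|` on `L`. -/
theorem integral_primitive_abs_inner (hL : IsSymmConvexBody L) {R : ℝ} (hR : 0 ≤ R)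
    (hLR : ∀ y ∈ L, |inner ℝ y x| ≤ R) {g : ℝ → ℝ} (hg : ContinuousOn g (Set.Icc 0 R))
    (hg0 : ∀ r ∈ Set.Icc 0 R, 0 ≤ g r) :
    ∫ y in L, (∫ r in (0 : ℝ)..|inner ℝ y x|, g r) = ∫ r in (0 : ℝ)..R, g r * slabTail L x r := by
  -- a continuous nonnegative extension of `g`
  set G : ℝ → ℝ := fun r => g (max 0 (min r R)) with hG
  have hGm : ∀ r, max 0 (min r R) ∈ Set.Icc 0 R := fun r =>
    ⟨le_max_left _ _, max_le hR (min_le_right _ _)⟩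
  have hGc : Continuous G := hg.comp_continuous (by fun_prop) hGm
  have hG0 : ∀ r, 0 ≤ G r := fun r => hg0 _ (hGm r)
  have hGg : ∀ r ∈ Set.Icc 0 R, G r = g r := fun r hr => by
    simp only [hG, min_eq_left hr.2, max_eq_right hr.1]
  have h1 : ∫ y in L, (∫ r in (0 : ℝ)..|inner ℝ y x|, g r) =
      ∫ y in L, (∫ r in (0 : ℝ)..|inner ℝ y x|, G r) := by
    refine setIntegral_congr_fun hL.measurableSet fun y hy => ?_
    refine intervalIntegral.integral_congr fun r hr => ?_
    rw [Set.uIcc_of_le (abs_nonneg _)] at hr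
    exact (hGg r ⟨hr.1, hr.2.trans (hLR y hy)⟩).symm
  have hcont : Continuous fun y : EuclideanSpace ℝ (Fin n) =>
      ∫ r in (0 : ℝ)..|inner ℝ y x|, G r :=
    (intervalIntegral.continuous_primitive (fun a b => hGc.intervalIntegrable a b) 0).comp
      (by fun_prop : Continuous fun y : EuclideanSpace ℝ (Fin n) => |inner ℝ y x|)
  rw [h1, integral_eq_lintegral_of_nonneg_ae (Filter.Eventually.of_forall fun y =>
      intervalIntegral.integral_nonneg (abs_nonneg _) fun r _ => hG0 r)
      hcont.aestronglyMeasurable,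
    lintegral_comp_eq_lintegral_meas_lt_mul _ (Filter.Eventually.of_forall fun y => abs_nonneg _)
      (by fun_prop : Continuous fun y : EuclideanSpace ℝ (Fin n) =>
        |inner ℝ y x|).aemeasurable (fun t _ => hGc.intervalIntegrable 0 t)
      (Filter.Eventually.of_forall hG0),
    intervalIntegral.integral_of_le hR, integral_eq_lintegral_of_nonneg_ae]
  rotate_left
  · filter_upwards [ae_restrict_mem measurableSet_Ioc] with r hr
    exact mul_nonneg (hg0 r ⟨hr.1.le, hr.2⟩) (slabTail_nonneg r)
  · exact ((hg.mono Set.Ioc_subset_Icc_self).aestronglyMeasurable measurableSet_Ioc).mul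
      hL.slabTail_antitone.measurable.aestronglyMeasurable
  congr 1
  rw [← lintegral_indicator measurableSet_Ioi, ← lintegral_indicator measurableSet_Ioc]
  congr 1
  ext t
  by_cases ht0 : 0 < t
  swap
  · simp [ht0]
  have hres : (volume.restrict L) {y | t < |inner ℝ y x|} = ENNReal.ofReal (slabTail L x t) := by
    rw [Measure.restrict_apply (measurableSet_lt_abs_inner t), Set.inter_comm, slabTail,
      Measure.real, ENNReal.ofReal_toReal (hL.inter_ne_top _)]
  rw [Set.indicator_of_mem (Set.mem_Ioi.2 ht0), hres]
  by_cases htR : t ≤ R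
  · rw [Set.indicator_of_mem (Set.mem_Ioc.2 ⟨ht0, htR⟩), hGg t ⟨ht0.le, htR⟩,
      ENNReal.ofReal_mul (hg0 t ⟨ht0.le, htR⟩), mul_comm]
  · rw [Set.indicator_of_notMem (fun h => htR h.2)]
    have : L ∩ {y | t < |inner ℝ y x|} = ∅ := by
      refine Set.eq_empty_of_forall_notMem fun y hy => ?_
      exact htR (hy.2.le.trans (hLR y hy.1))
    simp [slabTail, this]

theorem integral_mul_slabTail (hL : IsSymmConvexBody L) {R : ℝ} (hR : 0 ≤ R)
    (hLR : ∀ y ∈ L, |inner ℝ y x| ≤ R) :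
    ∫ r in (0 : ℝ)..R, r * slabTail L x r = volume.real L * (binetForm L x / 2) := by
  have h := hL.integral_primitive_abs_inner hR hLR (g := fun r => r) continuousOn_id
    (fun r hr => hr.1)
  rw [← h]
  simp_rw [integral_id, sq_abs]
  rw [integral_div, zero_pow two_ne_zero]
  simp_rw [sub_zero]
  rw [hL.integral_inner_sq]
  ring

theorem exists_abs_inner_le (hL : IsSymmConvexBody L) (x : EuclideanSpace ℝ (Fin n)) :
    ∃ R, 0 ≤ R ∧ ∀ y ∈ L, |inner ℝ y x| ≤ R := by
  obtain ⟨R, hR, h⟩ := hL.exists_norm_le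
  refine ⟨R * ‖x‖, by positivity, fun y hy => (abs_real_inner_le_norm y x).trans ?_⟩
  gcongr
  exact h y hy

theorem binetForm_pos (hL : IsSymmConvexBody L) (hx : x ≠ 0) : 0 < binetForm L x := by
  refine lt_of_le_of_ne (binetForm_nonneg x) fun h0 => hL.volume_real_pos.ne' ?_
  have h : ∫ y in L, (inner ℝ y x) ^ 2 = 0 := by rw [hL.integral_inner_sq, ← h0, mul_zero]
  rw [setIntegral_eq_zero_iff_of_nonneg_ae (Filter.Eventually.of_forall fun y => sq_nonneg _)
    (hL.integrableOn (by fun_prop))] at h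
  have h' : ∀ᵐ y ∂volume.restrict L, inner ℝ y x = 0 := by
    filter_upwards [h] with y hy
    simpa using hy
  rw [ae_restrict_iff' hL.measurableSet, ae_iff] at h'
  have : volume L = 0 := by
    refine measure_mono_null (fun y hy => ?_)
      (measure_union_null (volume_inner_eq_zero hx 0) h')
    by_cases hyx : inner ℝ y x = 0
    · exact Or.inl hyx
    · exact Or.inr fun h => hyx (h hy)
  simp [Measure.real, this]

/-- The second moment of `⟨·, x⟩` on `L` controls its maximum; the double cone is extremal. The
bound on the tails holds on `L` up to a null set, hence on the open set `interior L`, hence on its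
closure. -/
theorem inner_sq_le (hL : IsSymmConvexBody L) (hn : n ≠ 0) (x : EuclideanSpace ℝ (Fin n))
    {y : EuclideanSpace ℝ (Fin n)} (hy : y ∈ L) :
    (inner ℝ y x) ^ 2 ≤ (n + 1) * (n + 2) / 2 * binetForm L x := by
  rcases eq_or_ne x 0 with rfl | hx
  · have := binetForm_nonneg (L := L) 0
    simpa using by positivity
  obtain ⟨R, hR, hLR⟩ := hL.exists_abs_inner_le x
  set α := √((n + 1) * (n + 2) / 2 * binetForm L x) with hα
  have hq := hL.binetForm_pos hx
  have hα0 : 0 < α := Real.sqrt_pos.2 (by positivity)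
  have hα2 : α ^ 2 = (n + 1) * (n + 2) / 2 * binetForm L x := Real.sq_sqrt (by positivity)
  have hzero : ∀ a, α < a → slabTail L x a = 0 := fun a ha => by
    refine (hL.concaveFromZero_slabTail hn).eq_zero_of_lt hn slabTail_nonneg hL.slabTail_antitone
      (by rw [slabTail_zero hx]; exact hL.volume_real_pos) hα0 (R := R) ?_ ?_ ha
    · intro r hr
      have : L ∩ {y | r < |inner ℝ y x|} = ∅ :=
        Set.eq_empty_of_forall_notMem fun z hz => (hz.2.trans_le (hLR z hz.1)).not_gt hr
      simp [slabTail, this]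
    · rw [hL.integral_mul_slabTail hR hLR, slabTail_zero hx, hα2]
      field_simp
  have hint : ∀ z ∈ interior L, |inner ℝ z x| ≤ α := by
    intro z hz
    by_contra hcon
    obtain ⟨a, ha, haz⟩ := exists_between (not_le.1 hcon)
    have hopen : IsOpen (interior L ∩ {y | a < |inner ℝ y x|}) :=
      isOpen_interior.inter (isOpen_lt continuous_const (by fun_prop))
    have hpos := hopen.measure_pos volume ⟨z, hz, haz⟩
    have hle := measure_mono (μ := volume) (Set.inter_subset_inter_left
      {y : EuclideanSpace ℝ (Fin n) | a < |inner ℝ y x|} (interior_subset (s := L)))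
    have h0 := hzero a ha
    rw [slabTail, Measure.real, ENNReal.toReal_eq_zero_iff] at h0
    rcases h0 with h0 | h0
    · exact (hpos.trans_le hle).ne' h0
    · exact hL.inter_ne_top _ h0
  have hcl : y ∈ closure (interior L) := by
    rw [hL.convex.closure_interior_eq_closure_of_nonempty_interior hL.nonempty_interior]
    exact subset_closure hy
  have hyα : |inner ℝ y x| ≤ α :=
    (closure_minimal (t := {y : EuclideanSpace ℝ (Fin n) | |inner ℝ y x| ≤ α}) hint
      (isClosed_le (by fun_prop) continuous_const)) hcl
  rw [← hα2, ← sq_abs]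
  gcongr

/-- The kernel `(1 - s)⁻⁽ⁿ⁺¹⁾` integrates over `L` to at most its integral over the double cone
with the same second moment. -/
theorem lintegral_kernel_le (hL : IsSymmConvexBody L) (hn : n ≠ 0) (x : EuclideanSpace ℝ (Fin n))
    (hx1 : (n + 1) * (n + 2) / 2 * binetForm L x < 1) :
    ∫⁻ y in L, (ENNReal.ofReal (1 - inner ℝ y x))⁻¹ ^ (n + 1) ≤
      ENNReal.ofReal (volume.real L / (1 - (n + 1) * (n + 2) / 2 * binetForm L x)) := by
  rcases eq_or_ne x 0 with rfl | hx
  · simp [binetForm, Measure.real, hL.volume_ne_top]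
  set α := √((n + 1) * (n + 2) / 2 * binetForm L x) with hα
  have hq := hL.binetForm_pos hx
  have hα0 : 0 < α := Real.sqrt_pos.2 (by positivity)
  have hα2 : α ^ 2 = (n + 1) * (n + 2) / 2 * binetForm L x := Real.sq_sqrt (by positivity)
  rw [← hα2] at hx1 ⊢
  have hα1 : α < 1 := by nlinarith
  have hLα : ∀ y ∈ L, |inner ℝ y x| ≤ α := fun y hy =>
    abs_le_of_sq_le_sq (by rw [hα2]; exact hL.inner_sq_le hn x hy) hα0.le
  set φ : ℝ → ℝ := fun r => ((1 - r)⁻¹ ^ (n + 1) + (1 + r)⁻¹ ^ (n + 1)) / 2 with hφ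
  set g : ℝ → ℝ := fun r => (n + 1) / 2 * ((1 - r)⁻¹ ^ (n + 2) - (1 + r)⁻¹ ^ (n + 2)) with hg
  have hne : ∀ r ∈ Set.Icc 0 α, 1 - r ≠ 0 ∧ 1 + r ≠ 0 := fun r hr =>
    ⟨by linarith [hr.2], by linarith [hr.1]⟩
  have hgc : ContinuousOn g (Set.Icc 0 α) :=
    continuousOn_const.mul (((ContinuousOn.inv₀ (by fun_prop) fun r hr => (hne r hr).1).pow _).sub
      ((ContinuousOn.inv₀ (by fun_prop) fun r hr => (hne r hr).2).pow _))
  obtain ⟨D, S, hD, -, hDS⟩ := exists_monotoneOn_inv_pow_sub_and_add (n + 2)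
  have hIco : ∀ r ∈ Set.Icc 0 α, r ∈ Set.Ico (0 : ℝ) 1 := fun r hr => ⟨hr.1, hr.2.trans_lt hα1⟩
  have hgψ : ∀ r ∈ Set.Icc 0 α, g r = r * ((n + 1) / 2 * D r) := fun r hr => by
    simp only [hg]
    rw [(hDS r (hIco r hr)).1]
    ring
  have hψ : MonotoneOn (fun r => ((n : ℝ) + 1) / 2 * D r) (Set.Icc 0 α) := fun r hr s hs hrs =>
    mul_le_mul_of_nonneg_left (hD (hIco r hr) (hIco s hs) hrs) (by positivity)
  have hg0 : ∀ r ∈ Set.Icc 0 α, 0 ≤ g r := fun r hr => by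
    rw [hgψ r hr]
    have h1 := (hDS r (hIco r hr)).2.2.1
    have h2 : (0 : ℝ) ≤ 2 * ((n + 2 : ℕ) : ℝ) := by positivity
    have h3 := hr.1
    have h4 := h2.trans h1
    positivity
  have hprim : ∀ b ∈ Set.Icc 0 α, ∫ r in (0 : ℝ)..b, g r = φ b - 1 := by
    intro b hb
    have hsub : Set.uIcc 0 b ⊆ Set.Icc 0 α := by
      rw [Set.uIcc_of_le hb.1]
      exact Set.Icc_subset_Icc_right hb.2
    have hd : ∀ r ∈ Set.uIcc 0 b, HasDerivAt φ (g r) r := by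
      intro r hr
      obtain ⟨hr1, hr2⟩ := hne r (hsub hr)
      have h1 := ((((hasDerivAt_id r).const_sub 1).inv hr1).pow (n + 1))
      have h2 := ((((hasDerivAt_id r).const_add 1).inv hr2).pow (n + 1))
      refine ((h1.add h2).div_const 2).congr_deriv ?_
      simp only [hg, Nat.add_sub_cancel, Pi.inv_apply, id]
      rw [neg_neg, one_div, ← inv_pow, neg_div, one_div, ← inv_pow]
      push_cast
      ring
    rw [intervalIntegral.integral_eq_sub_of_hasDerivAt hd
      ((hgc.mono hsub).intervalIntegrable)]
    simp [hφ]
  have hlayer := hL.integral_primitive_abs_inner hα0.le hLα hgc hg0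
  have hcmp := (hL.concaveFromZero_slabTail (x := x) hn).integral_le hn slabTail_nonneg
    hL.slabTail_antitone hα0 (by
      rw [hL.integral_mul_slabTail hα0.le hLα, slabTail_zero hx, hα2]
      field_simp) hgc hψ hgψ
  have hcone : ∫ r in (0 : ℝ)..α, g r * (1 - r / α) ^ n = α ^ 2 / (1 - α ^ 2) := by
    have h1 := integral_inv_pow_mul_one_sub_div_pow n (c := 1) hα0 (by linarith)
    have h2 := integral_inv_pow_mul_one_sub_div_pow n (c := -1) hα0 (by linarith)
    have hi : ∀ c : ℝ, c = 1 ∨ c = -1 → IntervalIntegrable (fun r : ℝ =>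
        (n + 1) * (1 - c * r)⁻¹ ^ (n + 2) * (1 - r / α) ^ n) volume 0 α := by
      intro c hc
      refine ContinuousOn.intervalIntegrable ?_
      rw [Set.uIcc_of_le hα0.le]
      refine ContinuousOn.mul (ContinuousOn.mul continuousOn_const (ContinuousOn.pow
        (ContinuousOn.inv₀ (by fun_prop) fun r hr => ?_) _)) (by fun_prop)
      rcases hc with rfl | rfl
      · simpa using (hne r hr).1
      · simpa using (hne r hr).2
    have e : ∀ r : ℝ, g r * (1 - r / α) ^ n =
        1 / 2 * ((n + 1) * (1 - 1 * r)⁻¹ ^ (n + 2) * (1 - r / α) ^ n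
          - (n + 1) * (1 - (-1) * r)⁻¹ ^ (n + 2) * (1 - r / α) ^ n) := fun r => by
      simp only [hg, one_mul, neg_mul, sub_neg_eq_add]
      ring
    simp_rw [e]
    rw [intervalIntegral.integral_const_mul, intervalIntegral.integral_sub (hi 1 (Or.inl rfl))
      (hi (-1) (Or.inr rfl)), h1, h2]
    have h3 : 1 - α ≠ 0 := by linarith
    have h4 : 1 + α ≠ 0 := by linarith
    rw [show 1 - α ^ 2 = (1 - α) * (1 + α) by ring]
    simp only [one_mul, neg_mul, sub_neg_eq_add]
    field_simp
    ring
  have hφint : ∫ y in L, φ (inner ℝ y x) ≤ volume.real L / (1 - α ^ 2) := by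
    have e : ∫ y in L, φ (inner ℝ y x) =
        ∫ y in L, (1 + ∫ r in (0 : ℝ)..|inner ℝ y x|, g r) := by
      refine setIntegral_congr_fun hL.measurableSet fun y hy => ?_
      rw [hprim _ ⟨abs_nonneg _, hLα y hy⟩, add_sub_cancel]
      rcases abs_choice (inner ℝ y x) with h | h
      · rw [h]
      · rw [h]
        simp only [hφ, sub_neg_eq_add, ← sub_eq_add_neg, add_comm]
    have hint : IntegrableOn (fun y => ∫ r in (0 : ℝ)..|inner ℝ y x|, g r) L := by
      have hc : ContinuousOn (fun y : EuclideanSpace ℝ (Fin n) => φ |inner ℝ y x| - 1) L := by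
        have hφc : ContinuousOn φ (Set.Icc 0 α) := ContinuousOn.div_const
          (((ContinuousOn.inv₀ (by fun_prop) fun r hr => (hne r hr).1).pow _).add
            ((ContinuousOn.inv₀ (by fun_prop) fun r hr => (hne r hr).2).pow _)) _
        exact (hφc.comp (by fun_prop) fun y hy => ⟨abs_nonneg _, hLα y hy⟩).sub continuousOn_const
      refine (hc.integrableOn_compact hL.isCompact).congr_fun (fun y hy => ?_) hL.measurableSet
      exact (hprim _ ⟨abs_nonneg _, hLα y hy⟩).symm
    rw [e, integral_add (hL.integrableOn continuous_const) hint, hlayer, setIntegral_const,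
      smul_eq_mul, mul_one]
    rw [slabTail_zero hx, hcone] at hcmp
    have h3 : 1 - α ^ 2 ≠ 0 := by linarith
    calc _ ≤ volume.real L + volume.real L * (α ^ 2 / (1 - α ^ 2)) := by gcongr
      _ = _ := by field_simp; ring
  have hker : ∀ y ∈ L, (ENNReal.ofReal (1 - inner ℝ y x))⁻¹ ^ (n + 1) +
      (ENNReal.ofReal (1 - inner ℝ (-y) x))⁻¹ ^ (n + 1) =
      2 * ENNReal.ofReal (φ (inner ℝ y x)) := by
    intro y hy
    obtain ⟨h1, h2⟩ := abs_le.1 (hLα y hy)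
    have h3 : 0 < 1 - inner ℝ y x := by linarith
    have h4 : 0 < 1 + inner ℝ y x := by linarith
    rw [inner_neg_left, sub_neg_eq_add, ← ENNReal.ofReal_inv_of_pos h3,
      ← ENNReal.ofReal_inv_of_pos h4, ← ENNReal.ofReal_pow (by positivity),
      ← ENNReal.ofReal_pow (by positivity), ← ENNReal.ofReal_add (by positivity) (by positivity),
      two_mul_ofReal]
    simp only [hφ]
    congr 1
    ring
  have hφ0 : ∀ y ∈ L, 0 ≤ φ (inner ℝ y x) := by
    intro y hy
    obtain ⟨h1, h2⟩ := abs_le.1 (hLα y hy)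
    have h3 : 0 < 1 - inner ℝ y x := by linarith
    have h4 : 0 < 1 + inner ℝ y x := by linarith
    simp only [hφ]
    positivity
  have hφcont : ContinuousOn (fun y : EuclideanSpace ℝ (Fin n) => φ (inner ℝ y x)) L := by
    refine ContinuousOn.div_const (((ContinuousOn.inv₀ (by fun_prop) fun y hy => ?_).pow _).add
            ((ContinuousOn.inv₀ (by fun_prop) fun y hy => ?_).pow _)) _
    · linarith [(abs_le.1 (hLα y hy)).2]
    · linarith [(abs_le.1 (hLα y hy)).1]
  have hmeas : Measurable fun y : EuclideanSpace ℝ (Fin n) =>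
      (ENNReal.ofReal (1 - inner ℝ y x))⁻¹ ^ (n + 1) := by fun_prop
  have h2 : 2 * ∫⁻ y in L, (ENNReal.ofReal (1 - inner ℝ y x))⁻¹ ^ (n + 1) =
      2 * ENNReal.ofReal (∫ y in L, φ (inner ℝ y x)) := by
    rw [ofReal_integral_eq_lintegral_ofReal (hφcont.integrableOn_compact hL.isCompact)
      ((ae_restrict_mem hL.measurableSet).mono hφ0),
      ← lintegral_const_mul' 2 (fun y => ENNReal.ofReal (φ (inner ℝ y x))) (by simp),
      ← setLIntegral_congr_fun hL.measurableSet hker, lintegral_add_left hmeas,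
      hL.lintegral_comp_neg (fun y => (ENNReal.ofReal (1 - inner ℝ y x))⁻¹ ^ (n + 1)), two_mul]
  rw [(ENNReal.mul_right_inj (by simp) (by simp)).1 h2]
  exact ENNReal.ofReal_le_ofReal hφint

/-- Lower bounds for the integral of the kernel `(1 - s)⁻⁽ⁿ⁺¹⁾` from bounds of its even part by
polynomials `b + c s²`. -/
theorem le_lintegral_kernel (hL : IsSymmConvexBody L) (hx : ∀ y ∈ L, inner ℝ y x ≤ 1) {b c : ℝ}
    (hbc : ∀ s : ℝ, |s| < 1 →
      2 * (b + c * s ^ 2) ≤ (1 - s)⁻¹ ^ (n + 1) + (1 + s)⁻¹ ^ (n + 1)) :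
    ENNReal.ofReal (volume.real L * (b + c * binetForm L x)) ≤
      ∫⁻ y in L, (ENNReal.ofReal (1 - inner ℝ y x))⁻¹ ^ (n + 1) := by
  have hker : ∀ y ∈ L, 2 * ENNReal.ofReal (b + c * (inner ℝ y x) ^ 2) ≤
      (ENNReal.ofReal (1 - inner ℝ y x))⁻¹ ^ (n + 1) +
      (ENNReal.ofReal (1 - inner ℝ (-y) x))⁻¹ ^ (n + 1) := by
    intro y hy
    have h1 := hx y hy
    have h2 := hx (-y) (hL.neg_mem y hy)
    rw [inner_neg_left] at h2 ⊢
    -- at the boundary of the slab the kernel is infinite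
    rcases h1.eq_or_lt with h1 | h1
    · simp [h1]
    rcases h2.eq_or_lt with h2 | h2
    · simp [h2]
    have h3 : 0 < 1 - inner ℝ y x := by linarith
    have h4 : 0 < 1 + inner ℝ y x := by linarith
    rw [sub_neg_eq_add, ← ENNReal.ofReal_inv_of_pos h3,
      ← ENNReal.ofReal_inv_of_pos h4, ← ENNReal.ofReal_pow (by positivity),
      ← ENNReal.ofReal_pow (by positivity), ← ENNReal.ofReal_add (by positivity) (by positivity),
      two_mul_ofReal]
    exact ENNReal.ofReal_le_ofReal (hbc _ (abs_lt.2 ⟨by linarith, h1⟩))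
  have hmeas : Measurable fun y : EuclideanSpace ℝ (Fin n) =>
      (ENNReal.ofReal (1 - inner ℝ y x))⁻¹ ^ (n + 1) := by fun_prop
  have hint : ∫ y in L, (b + c * (inner ℝ y x) ^ 2) = volume.real L * (b + c * binetForm L x) := by
    rw [integral_add (hL.integrableOn continuous_const) (hL.integrableOn (by fun_prop)),
      integral_const_mul, hL.integral_inner_sq, setIntegral_const, smul_eq_mul]
    ring
  have hle : ENNReal.ofReal (∫ y in L, (b + c * (inner ℝ y x) ^ 2)) ≤
      ∫⁻ y in L, ENNReal.ofReal (b + c * (inner ℝ y x) ^ 2) := by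
    have hc : Continuous fun y : EuclideanSpace ℝ (Fin n) => max (b + c * (inner ℝ y x) ^ 2) 0 := by
      fun_prop
    calc _ ≤ ENNReal.ofReal (∫ y in L, max (b + c * (inner ℝ y x) ^ 2) 0) :=
          ENNReal.ofReal_le_ofReal (setIntegral_mono (hL.integrableOn (by fun_prop))
            (hL.integrableOn hc) fun y => le_max_left _ _)
      _ = _ := by
        rw [ofReal_integral_eq_lintegral_ofReal (hL.integrableOn hc)
          (Filter.Eventually.of_forall fun y => le_max_right _ _)]
        simp
  rw [← hint]
  refine hle.trans ((ENNReal.mul_le_mul_iff_right (a := 2) (by simp) (by simp)).1 ?_)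
  calc 2 * ∫⁻ y in L, ENNReal.ofReal (b + c * (inner ℝ y x) ^ 2)
      = ∫⁻ y in L, 2 * ENNReal.ofReal (b + c * (inner ℝ y x) ^ 2) :=
        (lintegral_const_mul' _ _ (by simp)).symm
    _ ≤ ∫⁻ y in L, ((ENNReal.ofReal (1 - inner ℝ y x))⁻¹ ^ (n + 1) +
      (ENNReal.ofReal (1 - inner ℝ (-y) x))⁻¹ ^ (n + 1)) :=
        setLIntegral_mono' hL.measurableSet hker
    _ = 2 * ∫⁻ y in L, (ENNReal.ofReal (1 - inner ℝ y x))⁻¹ ^ (n + 1) := by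
      rw [lintegral_add_left hmeas,
        hL.lintegral_comp_neg (fun y => (ENNReal.ofReal (1 - inner ℝ y x))⁻¹ ^ (n + 1)), two_mul]

end IsSymmConvexBody

/-! ### The Binet ellipsoid and the Santaló regions -/

theorem mem_binetEllipsoid : x ∈ binetEllipsoid L ↔ binetForm L x ≤ 1 := Iff.rfl

theorem binetForm_smul (c : ℝ) (x : EuclideanSpace ℝ (Fin n)) :
    binetForm L (c • x) = c ^ 2 * binetForm L x := by
  simp only [binetForm, real_inner_smul_right, mul_pow]
  rw [integral_const_mul]
  ring

theorem inner_le_one_of_mem_polarAt_zero (hx : x ∈ K) {y : EuclideanSpace ℝ (Fin n)} (hy : y ∈ polarAt K 0) :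
    inner ℝ y x ≤ 1 :=
  mem_polarAt_zero.1 hy x hx

/-- Convexity of `s ↦ (1 - s)⁻⁽ᵐ⁺¹⁾` on `s ≤ 1`, with the value `∞` at `s = 1`. -/
theorem kernel_combo_le {m : ℕ} {r s a b : ℝ} (hr : r ≤ 1) (hs : s ≤ 1) (ha : 0 ≤ a) (hb : 0 ≤ b)
    (hab : a + b = 1) :
    (ENNReal.ofReal (1 - (a * r + b * s)))⁻¹ ^ (m + 1) ≤
      ENNReal.ofReal a * (ENNReal.ofReal (1 - r))⁻¹ ^ (m + 1) +
      ENNReal.ofReal b * (ENNReal.ofReal (1 - s))⁻¹ ^ (m + 1) := by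
  rcases ha.eq_or_lt with rfl | ha
  · obtain rfl : b = 1 := by linarith
    simp
  rcases hb.eq_or_lt with rfl | hb
  · obtain rfl : a = 1 := by linarith
    simp
  rcases hr.eq_or_lt with rfl | hr
  · simp [ENNReal.mul_top, ha]
  rcases hs.eq_or_lt with rfl | hs
  · simp [ENNReal.mul_top, hb]
  have h1 : 0 < 1 - r := by linarith
  have h2 : 0 < 1 - s := by linarith
  have e : 1 - (a * r + b * s) = a * (1 - r) + b * (1 - s) := by linear_combination -hab
  have h3 : 0 < 1 - (a * r + b * s) := by rw [e]; positivity
  rw [← ENNReal.ofReal_inv_of_pos h1, ← ENNReal.ofReal_inv_of_pos h2,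
    ← ENNReal.ofReal_inv_of_pos h3, ← ENNReal.ofReal_pow (by positivity),
    ← ENNReal.ofReal_pow (by positivity), ← ENNReal.ofReal_pow (by positivity),
    ← ENNReal.ofReal_mul ha.le, ← ENNReal.ofReal_mul hb.le,
    ← ENNReal.ofReal_add (by positivity) (by positivity)]
  refine ENNReal.ofReal_le_ofReal ?_
  have h := (convexOn_zpow (𝕜 := ℝ) (-(m + 1 : ℤ))).2 h1 h2 ha.le hb.le hab
  have hz : ∀ w : ℝ, w ^ (-(m + 1 : ℤ)) = w⁻¹ ^ (m + 1) := fun w => by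
    rw [zpow_neg, inv_pow]
    norm_cast
  simp only [smul_eq_mul, hz] at h
  rwa [e]

namespace IsSymmConvexBody

theorem continuous_binetForm (hL : IsSymmConvexBody L) : Continuous (binetForm L) :=
  continuous_const.mul (continuous_parametric_integral_of_continuous
    (f := fun x y : EuclideanSpace ℝ (Fin n) => (inner ℝ y x) ^ 2) (by fun_prop) hL.isCompact)

theorem binetForm_combo_le (hL : IsSymmConvexBody L) (x z : EuclideanSpace ℝ (Fin n)) {a b : ℝ}
    (ha : 0 ≤ a) (hb : 0 ≤ b) (hab : a + b = 1) :
    binetForm L (a • x + b • z) ≤ a * binetForm L x + b * binetForm L z := by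
  have hi : ∀ w : EuclideanSpace ℝ (Fin n), IntegrableOn (fun y => (inner ℝ y w) ^ 2) L :=
    fun w => hL.integrableOn (by fun_prop)
  have h : ∫ y in L, (inner ℝ y (a • x + b • z)) ^ 2 ≤
      ∫ y in L, (a * (inner ℝ y x) ^ 2 + b * (inner ℝ y z) ^ 2) := by
    refine setIntegral_mono (hi _) (((hi x).const_mul a).add ((hi z).const_mul b)) fun y => ?_
    simp only [inner_add_right, real_inner_smul_right]
    obtain rfl : b = 1 - a := by linarith
    nlinarith [mul_nonneg (mul_nonneg ha hb) (sq_nonneg (inner ℝ y x - inner ℝ y z))]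
  rw [integral_add ((hi x).const_mul a) ((hi z).const_mul b), integral_const_mul,
    integral_const_mul, hL.integral_inner_sq, hL.integral_inner_sq, hL.integral_inner_sq] at h
  refine le_of_mul_le_mul_left (h.trans_eq ?_) hL.volume_real_pos
  ring

protected theorem binetEllipsoid (hL : IsSymmConvexBody L) (hn : n ≠ 0) :
    IsSymmConvexBody (binetEllipsoid L) := by
  refine ⟨?_, ?_, ?_, ?_⟩
  · intro x hx z hz a b ha hb hab
    rw [mem_binetEllipsoid] at *
    refine (hL.binetForm_combo_le x z ha hb hab).trans ?_
    nlinarith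
  · refine Metric.isCompact_of_isClosed_isBounded
      (isClosed_le hL.continuous_binetForm continuous_const) ?_
    obtain ⟨r, hr, hrL⟩ := hL.exists_ball_subset
    refine isBounded_iff_forall_norm_le.2 ⟨√((n + 1) * (n + 2) / 2) / r, fun u hu => ?_⟩
    rcases eq_or_ne u 0 with rfl | hu0
    · simp only [norm_zero]
      positivity
    have hun : 0 < ‖u‖ := norm_pos_iff.2 hu0
    have h := hL.inner_sq_le hn u (y := (r / ‖u‖) • u) (hrL (by
      simp [norm_smul, abs_of_pos hr, hun.ne']))
    rw [real_inner_smul_left, real_inner_self_eq_norm_sq,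
      show r / ‖u‖ * ‖u‖ ^ 2 = ‖u‖ * r by field_simp] at h
    rw [le_div_iff₀ hr]
    refine Real.le_sqrt_of_sq_le (h.trans ?_)
    have := mem_binetEllipsoid.1 hu
    exact mul_le_of_le_one_right (by positivity) this
  · refine ⟨0, mem_interior.2 ⟨{u | binetForm L u < 1}, fun u hu => mem_binetEllipsoid.2 hu.le,
      isOpen_lt hL.continuous_binetForm continuous_const, ?_⟩⟩
    simp [binetForm]
  · intro u hu
    rw [mem_binetEllipsoid, ← neg_one_smul ℝ u, binetForm_smul] at *
    simpa using hu

theorem mem_smul_binetEllipsoid (hL : IsSymmConvexBody L) {c : ℝ} (hc : 0 ≤ c)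
    (h : binetForm L x ≤ c ^ 2) : x ∈ c • binetEllipsoid L := by
  rcases hc.eq_or_lt with rfl | hc
  · have hx : x = 0 := by
      by_contra hx
      have := hL.binetForm_pos hx
      simp at h
      linarith
    exact ⟨0, by simp [mem_binetEllipsoid, binetForm], by simp [hx]⟩
  · rw [Set.mem_smul_set_iff_inv_smul_mem₀ hc.ne', mem_binetEllipsoid, binetForm_smul, inv_pow,
      inv_mul_le_iff₀ (by positivity), mul_one]
    exact h

theorem binetForm_polarAt_le_one (hK : IsSymmConvexBody K) (hx : x ∈ K) :
    binetForm (polarAt K 0) x ≤ 1 := by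
  have hL := hK.polar
  have h : ∫ y in polarAt K 0, (inner ℝ y x) ^ 2 ≤ ∫ y in polarAt K 0, (1 : ℝ) := by
    refine setIntegral_mono_on (hL.integrableOn (by fun_prop)) (hL.integrableOn continuous_const)
      hL.measurableSet fun y hy => ?_
    have h1 := inner_le_one_of_mem_polarAt_zero hx hy
    have h2 := inner_le_one_of_mem_polarAt_zero hx (hL.neg_mem y hy)
    rw [inner_neg_left] at h2
    nlinarith
  rw [hL.integral_inner_sq, setIntegral_const, smul_eq_mul] at h
  exact le_of_mul_le_mul_left h hL.volume_real_pos

theorem volume_polarAt_le (hK : IsSymmConvexBody K) (hn : n ≠ 0) (hx : x ∈ K)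
    (hx1 : (n + 1) * (n + 2) / 2 * binetForm (polarAt K 0) x < 1) :
    volume (polarAt K x) ≤ ENNReal.ofReal (volume.real (polarAt K 0) /
      (1 - (n + 1) * (n + 2) / 2 * binetForm (polarAt K 0) x)) := by
  rw [volume_polarAt hK hx]
  exact hK.polar.lintegral_kernel_le hn x hx1

/-- A point with small Binet form lies in `K`, because by `inner_sq_le` it pairs to at most `1` with
all of the polar body. -/
theorem mem_of_binetForm_lt (hK : IsSymmConvexBody K) (hn : n ≠ 0)
    (hx1 : (n + 1) * (n + 2) / 2 * binetForm (polarAt K 0) x < 1) : x ∈ K := by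
  by_contra hx
  obtain ⟨y, hy, hyx⟩ := hK.exists_one_lt_inner hx
  have := hK.polar.inner_sq_le hn x hy
  nlinarith

theorem quadratic_le_volume_polarAt (hK : IsSymmConvexBody K) (hx : x ∈ K) :
    ENNReal.ofReal (volume.real (polarAt K 0) *
      (1 + (n + 1) * (n + 2) / 2 * binetForm (polarAt K 0) x)) ≤ volume (polarAt K x) := by
  rw [volume_polarAt hK hx]
  refine hK.polar.le_lintegral_kernel (fun y hy => inner_le_one_of_mem_polarAt_zero hx hy)
    fun s hs => ?_
  have := quadratic_le_inv_pow_add (m := n + 1) hs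
  push_cast at this
  linarith

/-- Jensen's inequality for `p ↦ (1 - p / 2)⁻ⁿ` and the values `p = ⟨y, x⟩²`. -/
theorem inv_pow_le_volume_polarAt (hK : IsSymmConvexBody K) (hx : x ∈ K) :
    ENNReal.ofReal (volume.real (polarAt K 0) * (1 - binetForm (polarAt K 0) x / 2)⁻¹ ^ n) ≤
      volume (polarAt K x) := by
  have hq := hK.binetForm_polarAt_le_one hx
  rw [volume_polarAt hK hx]
  set q := binetForm (polarAt K 0) x with hqdef
  have hM : 0 < 1 - q / 2 := by linarith
  -- the tangent line at `q` of the convex function `p ↦ (1 - p / 2)⁻ⁿ`, written as `b + c p`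
  have h := hK.polar.le_lintegral_kernel (fun y hy => inner_le_one_of_mem_polarAt_zero hx hy)
    (b := (1 - q / 2)⁻¹ ^ n * (1 - n * ((1 - q / 2)⁻¹ - 1)))
    (c := (1 - q / 2)⁻¹ ^ n * (n * (1 - q / 2)⁻¹ / 2)) fun s hs => by
      have hs2 : s ^ 2 < 1 := (sq_lt_one_iff_abs_lt_one s).2 hs
      have h1 := tangent_le_inv_pow (n := n) (p := q) (q := s ^ 2) (by linarith) (by linarith)
      have h2 := inv_pow_le_inv_pow_add (n := n) hs
      refine le_trans (le_of_eq ?_) ((mul_le_mul_of_nonneg_left h1 zero_le_two).trans h2)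
      rw [div_eq_mul_inv (1 - s ^ 2 / 2)]
      ring
  rw [← hqdef] at h
  convert h using 3
  generalize hw : (1 - q / 2)⁻¹ = w
  have e : w * (1 - q / 2) = 1 := by rw [← hw, inv_mul_cancel₀ hM.ne']
  linear_combination (w ^ n * n) * e

end IsSymmConvexBody

theorem unitBallVolume_pos (n : ℕ) : 0 < unitBallVolume n :=
  ENNReal.toReal_pos (Metric.measure_ball_pos _ _ one_pos).ne' measure_ball_lt_top.ne

namespace IsSymmConvexBody

/-- Membership in the Santaló region as a single inequality in `ℝ≥0∞`, which includes the finiteness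
of the volume. -/
theorem mem_santaloRegion_iff (hK : IsSymmConvexBody K) {t : ℝ} (ht : 0 ≤ t) :
    x ∈ santaloRegion K t ↔ x ∈ K ∧
      volume (polarAt K x) ≤ ENNReal.ofReal (t * unitBallVolume n ^ 2 / volume.real K) := by
  have hκ := hK.volume_real_pos
  have hv := unitBallVolume_pos n
  have h : ∀ V : ℝ, volume.real K * V / unitBallVolume n ^ 2 ≤ t ↔
      V ≤ t * unitBallVolume n ^ 2 / volume.real K := fun V => by
    rw [div_le_iff₀ (by positivity), le_div_iff₀ hκ, mul_comm V]
  rw [santaloRegion, Set.mem_ofPred_eq, h]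
  refine and_congr_right fun _ => ⟨fun ⟨h1, h2⟩ => ?_, fun h1 => ?_⟩
  · rwa [ENNReal.le_ofReal_iff_toReal_le h1 (by positivity)]
  · have h2 := ne_top_of_le_ne_top ENNReal.ofReal_ne_top h1
    exact ⟨h2, (ENNReal.le_ofReal_iff_toReal_le h2 (by positivity)).1 h1⟩

/-- Among all points of `K`, the origin minimizes the volume of the polar body. -/
theorem le_of_mem_santaloRegion (hK : IsSymmConvexBody K) {t : ℝ} (hx : x ∈ santaloRegion K t) :
    volume.real K * volume.real (polarAt K 0) / unitBallVolume n ^ 2 ≤ t := by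
  obtain ⟨hxK, hfin, hle⟩ := hx
  refine le_trans ?_ hle
  have h := hK.quadratic_le_volume_polarAt hxK
  rw [ENNReal.ofReal_le_iff_le_toReal hfin] at h
  change _ ≤ volume.real (polarAt K x) at h
  have hκ := hK.volume_real_pos
  have hq := binetForm_nonneg (L := polarAt K 0) x
  have hV := hK.polar.volume_real_pos
  have hpos : 0 ≤ volume.real (polarAt K 0) *
      ((n + 1) * (n + 2) / 2 * binetForm (polarAt K 0) x) := by positivity
  have hle : volume.real (polarAt K 0) ≤ volume.real (polarAt K x) := by linarith
  exact div_le_div_of_nonneg_right (mul_le_mul_of_nonneg_left hle hκ.le) (by positivity)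

theorem smul_binetEllipsoid_subset (hK : IsSymmConvexBody K) (hn : n ≠ 0) {t : ℝ}
    (ht : volume.real K * volume.real (polarAt K 0) / unitBallVolume n ^ 2 ≤ t) :
    innerRadius K t • binetEllipsoid (polarAt K 0) ⊆ santaloRegion K t := by
  have hκ := hK.volume_real_pos
  have hV := hK.polar.volume_real_pos
  have hv := unitBallVolume_pos n
  have ht0 : 0 < t := lt_of_lt_of_le (by positivity) ht
  rintro _ ⟨u, hu, rfl⟩
  rw [mem_binetEllipsoid] at hu
  simp only
  set ρ := volume.real K * volume.real (polarAt K 0) / (t * unitBallVolume n ^ 2) with hρ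
  have hρ0 : 0 < ρ := by positivity
  have hρ1 : ρ ≤ 1 := by
    rw [div_le_iff₀ (by positivity)] at ht
    rwa [hρ, div_le_one (by positivity)]
  have hd2 : innerRadius K t ^ 2 = 1 / (3 * n ^ 2) * (1 - ρ) := by
    rw [innerRadius, ← hρ, mul_pow, div_pow, mul_pow, Real.sq_sqrt (by norm_num),
      Real.sq_sqrt (by linarith), one_pow]
  have hn1 : (1 : ℝ) ≤ n := by exact_mod_cast Nat.one_le_iff_ne_zero.2 hn
  have hform : (n + 1) * (n + 2) / 2 * binetForm (polarAt K 0) (innerRadius K t • u) ≤ 1 - ρ := by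
    rw [binetForm_smul, hd2]
    have h1 : ((n : ℝ) + 1) * (n + 2) / 2 * (1 / (3 * n ^ 2)) ≤ 1 := by
      -- `6 n² - (n + 1) (n + 2) = (n - 1) (5 n + 2)`
      rw [mul_one_div, div_le_one (by positivity)]
      nlinarith
    calc ((n : ℝ) + 1) * (n + 2) / 2 * (1 / (3 * n ^ 2) * (1 - ρ) * binetForm (polarAt K 0) u)
        = (((n : ℝ) + 1) * (n + 2) / 2 * (1 / (3 * n ^ 2))) * (1 - ρ) *
            binetForm (polarAt K 0) u := by ring
      _ ≤ 1 * (1 - ρ) * 1 := by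
        have : 0 ≤ 1 - ρ := by linarith
        gcongr
        exact binetForm_nonneg u
      _ = 1 - ρ := by ring
  have hlt : (n + 1) * (n + 2) / 2 * binetForm (polarAt K 0) (innerRadius K t • u) < 1 := by
    linarith
  have hmem := hK.mem_of_binetForm_lt hn hlt
  rw [hK.mem_santaloRegion_iff ht0.le]
  refine ⟨hmem, (hK.volume_polarAt_le hn hmem hlt).trans (ENNReal.ofReal_le_ofReal ?_)⟩
  calc _ ≤ volume.real (polarAt K 0) / ρ := by
        gcongr
        linarith
    _ = _ := by
      rw [hρ]
      field_simp

/-- `S(K, t)` lies in the multiple of the Binet ellipsoid given by the first term of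
`outerRadius`. -/
theorem binetForm_le_first (hK : IsSymmConvexBody K) {t : ℝ} (hx : x ∈ santaloRegion K t) :
    binetForm (polarAt K 0) x ≤
    (√(2 / (((n : ℝ) + 1) * ((n : ℝ) + 2))) *
      √(t * unitBallVolume n ^ 2 / (volume.real K * volume.real (polarAt K 0))) *
      √(1 - volume.real K * volume.real (polarAt K 0) / (t * unitBallVolume n ^ 2))) ^ 2 := by
  have hκ := hK.volume_real_pos
  have hV := hK.polar.volume_real_pos
  have hv := unitBallVolume_pos n
  have ht := hK.le_of_mem_santaloRegion hx
  have ht0 : 0 < t := lt_of_lt_of_le (by positivity) ht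
  have hρ1 : volume.real K * volume.real (polarAt K 0) / (t * unitBallVolume n ^ 2) ≤ 1 := by
    rw [div_le_iff₀ (by positivity)] at ht
    rwa [div_le_one (by positivity)]
  obtain ⟨hxK, hle⟩ := (hK.mem_santaloRegion_iff ht0.le).1 hx
  have h := (hK.quadratic_le_volume_polarAt hxK).trans hle
  rw [ENNReal.ofReal_le_ofReal_iff (by positivity), le_div_iff₀ hκ] at h
  rw [mul_pow, mul_pow, Real.sq_sqrt (by positivity), Real.sq_sqrt (by positivity),
    Real.sq_sqrt (by linarith)]
  have e : 2 / (((n : ℝ) + 1) * ((n : ℝ) + 2)) *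
      (t * unitBallVolume n ^ 2 / (volume.real K * volume.real (polarAt K 0))) *
      (1 - volume.real K * volume.real (polarAt K 0) / (t * unitBallVolume n ^ 2)) =
      (t * unitBallVolume n ^ 2 - volume.real K * volume.real (polarAt K 0)) /
        (volume.real K * volume.real (polarAt K 0) * ((n + 1) * (n + 2) / 2)) := by
    field_simp
  rw [e, le_div_iff₀ (by positivity)]
  linarith

/-- `S(K, t)` lies in the multiple of the Binet ellipsoid given by the second term of
`outerRadius`. -/
theorem binetForm_le_second (hK : IsSymmConvexBody K) (hn : n ≠ 0) {t : ℝ}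
    (hx : x ∈ santaloRegion K t) :
    binetForm (polarAt K 0) x ≤ (√2 *
      √(1 - (volume.real K * volume.real (polarAt K 0) / (t * unitBallVolume n ^ 2)) ^
        (1 / (n : ℝ)))) ^ 2 := by
  have hκ := hK.volume_real_pos
  have hV := hK.polar.volume_real_pos
  have hv := unitBallVolume_pos n
  have ht := hK.le_of_mem_santaloRegion hx
  have ht0 : 0 < t := lt_of_lt_of_le (by positivity) ht
  obtain ⟨hxK, hle⟩ := (hK.mem_santaloRegion_iff ht0.le).1 hx
  have h := (hK.inv_pow_le_volume_polarAt hxK).trans hle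
  have hq1 := hK.binetForm_polarAt_le_one hxK
  set q := binetForm (polarAt K 0) x with hq
  have hq0 : 0 ≤ q := binetForm_nonneg x
  have hM : 0 < 1 - q / 2 := by linarith
  set ρ := volume.real K * volume.real (polarAt K 0) / (t * unitBallVolume n ^ 2) with hρ
  have hρ0 : 0 < ρ := by positivity
  rw [ENNReal.ofReal_le_ofReal_iff (by positivity), le_div_iff₀ hκ] at h
  have hρM : ρ ≤ (1 - q / 2) ^ n := by
    rw [hρ, div_le_iff₀ (by positivity)]
    rw [inv_pow] at h
    have hMn : 0 < (1 - q / 2) ^ n := by positivity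
    calc volume.real K * volume.real (polarAt K 0)
        = (1 - q / 2) ^ n * (volume.real (polarAt K 0) * ((1 - q / 2) ^ n)⁻¹ * volume.real K) := by
          generalize (1 - q / 2) ^ n = w at hMn
          field_simp
      _ ≤ _ := by gcongr
  have hroot : ρ ^ (1 / (n : ℝ)) ≤ 1 - q / 2 := by
    calc ρ ^ (1 / (n : ℝ)) ≤ ((1 - q / 2) ^ n) ^ (1 / (n : ℝ)) := by gcongr
      _ = 1 - q / 2 := by rw [one_div, Real.pow_rpow_inv_natCast hM.le hn]
  rw [mul_pow, Real.sq_sqrt (by norm_num), Real.sq_sqrt (by linarith)]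
  linarith

theorem santaloRegion_subset (hK : IsSymmConvexBody K) (hn : n ≠ 0) (t : ℝ) :
    santaloRegion K t ⊆ outerRadius K t • binetEllipsoid (polarAt K 0) := by
  intro x hx
  refine hK.polar.mem_smul_binetEllipsoid (le_min (by positivity) (by positivity)) ?_
  exact min_rec' (fun c => binetForm (polarAt K 0) x ≤ c ^ 2) (hK.binetForm_le_first hx)
    (hK.binetForm_le_second hn hx)

theorem volume_polarAt_combo_le (hK : IsSymmConvexBody K) {z : EuclideanSpace ℝ (Fin n)}
    (hx : x ∈ K) (hz : z ∈ K) {a b : ℝ} (ha : 0 ≤ a) (hb : 0 ≤ b) (hab : a + b = 1) :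
    volume (polarAt K (a • x + b • z)) ≤
      ENNReal.ofReal a * volume (polarAt K x) + ENNReal.ofReal b * volume (polarAt K z) := by
  rw [volume_polarAt hK hx, volume_polarAt hK hz, volume_polarAt hK (hK.convex hx hz ha hb hab),
    ← lintegral_const_mul' _ _ ENNReal.ofReal_ne_top,
    ← lintegral_const_mul' _ _ ENNReal.ofReal_ne_top, ← lintegral_add_left (by fun_prop)]
  refine setLIntegral_mono' hK.polar.measurableSet fun y hy => ?_
  rw [inner_add_right, real_inner_smul_right, real_inner_smul_right]
  exact kernel_combo_le (inner_le_one_of_mem_polarAt_zero hx hy)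
    (inner_le_one_of_mem_polarAt_zero hz hy) ha hb hab

/-- `x ↦ |K^x|` is lower semicontinuous on `K`, by Fatou's lemma. -/
theorem isClosed_santaloRegion (hK : IsSymmConvexBody K) {t : ℝ} (ht : 0 ≤ t) :
    IsClosed (santaloRegion K t) := by
  refine IsSeqClosed.isClosed fun u x hu hux => ?_
  rw [hK.mem_santaloRegion_iff ht]
  have hmem := fun k => (hK.mem_santaloRegion_iff ht).1 (hu k)
  have hx : x ∈ K := hK.isCompact.isClosed.mem_of_tendsto hux
    (Filter.Eventually.of_forall fun k => (hmem k).1)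
  refine ⟨hx, ?_⟩
  rw [volume_polarAt hK hx]
  have hlim : ∀ y : EuclideanSpace ℝ (Fin n), Filter.liminf (fun k =>
      (ENNReal.ofReal (1 - inner ℝ y (u k)))⁻¹ ^ (n + 1)) Filter.atTop =
      (ENNReal.ofReal (1 - inner ℝ y x))⁻¹ ^ (n + 1) := fun y => by
    refine Filter.Tendsto.liminf_eq ?_
    have hc : Continuous fun z : EuclideanSpace ℝ (Fin n) =>
        (ENNReal.ofReal (1 - inner ℝ y z))⁻¹ ^ (n + 1) :=
      (ENNReal.continuous_pow (n + 1)).comp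
        (ENNReal.continuous_ofReal.comp (by fun_prop : Continuous fun z => 1 - inner ℝ y z)).inv
    exact (hc.tendsto x).comp hux
  simp_rw [← hlim]
  refine (lintegral_liminf_le fun k => by fun_prop).trans ?_
  refine Filter.liminf_le_of_le (by isBoundedDefault) fun c hc => ?_
  obtain ⟨k, hk⟩ := hc.exists
  rw [← volume_polarAt hK (hmem k).1] at hk
  exact hk.trans (hmem k).2

theorem volume_polarAt_neg (hK : IsSymmConvexBody K) (hx : x ∈ K) :
    volume (polarAt K (-x)) = volume (polarAt K x) := by
  rw [volume_polarAt hK hx, volume_polarAt hK (hK.neg_mem x hx), ← hK.polar.lintegral_comp_neg]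
  simp

theorem innerRadius_pos (hK : IsSymmConvexBody K) (hn : n ≠ 0) {t : ℝ}
    (ht : volume.real K * volume.real (polarAt K 0) / unitBallVolume n ^ 2 < t) :
    0 < innerRadius K t := by
  have hκ := hK.volume_real_pos
  have hV := hK.polar.volume_real_pos
  have hv := unitBallVolume_pos n
  have ht0 : 0 < t := lt_trans (by positivity) ht
  have hn0 : (0 : ℝ) < n := by exact_mod_cast Nat.pos_of_ne_zero hn
  have hρ1 : volume.real K * volume.real (polarAt K 0) / (t * unitBallVolume n ^ 2) < 1 := by
    rw [div_lt_iff₀ (by positivity)] at ht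
    rwa [div_lt_one (by positivity)]
  have := Real.sqrt_pos.2 (sub_pos.2 hρ1)
  rw [innerRadius]
  positivity

protected theorem santaloRegion (hK : IsSymmConvexBody K) (hn : n ≠ 0) {t : ℝ}
    (ht : volume.real K * volume.real (polarAt K 0) / unitBallVolume n ^ 2 < t) :
    IsSymmConvexBody (santaloRegion K t) := by
  have hκ := hK.volume_real_pos
  have hV := hK.polar.volume_real_pos
  have hv := unitBallVolume_pos n
  have ht0 : 0 < t := lt_trans (by positivity) ht
  refine ⟨?_, ?_, ?_, ?_⟩
  · intro x hx z hz a b ha hb hab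
    rw [hK.mem_santaloRegion_iff ht0.le] at *
    refine ⟨hK.convex hx.1 hz.1 ha hb hab,
      (hK.volume_polarAt_combo_le hx.1 hz.1 ha hb hab).trans ?_⟩
    calc _ ≤ ENNReal.ofReal a * ENNReal.ofReal (t * unitBallVolume n ^ 2 / volume.real K) +
          ENNReal.ofReal b * ENNReal.ofReal (t * unitBallVolume n ^ 2 / volume.real K) := by
          gcongr
          · exact hx.2
          · exact hz.2
      _ = _ := by
        rw [← add_mul, ← ENNReal.ofReal_add ha hb, hab, ENNReal.ofReal_one, one_mul]
  · exact hK.isCompact.of_isClosed_subset (hK.isClosed_santaloRegion ht0.le) fun x hx => hx.1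
  · have h := (hK.polar.binetEllipsoid hn).nonempty_interior.image
      (fun u => innerRadius K t • u)
    refine Set.Nonempty.mono ?_ h
    change innerRadius K t • interior (binetEllipsoid (polarAt K 0)) ⊆ _
    rw [← interior_smul₀ (hK.innerRadius_pos hn ht).ne']
    exact interior_mono (hK.smul_binetEllipsoid_subset hn ht.le)
  · intro x hx
    rw [hK.mem_santaloRegion_iff ht0.le] at *
    exact ⟨hK.neg_mem x hx.1, (hK.volume_polarAt_neg hx.1).trans_le hx.2⟩

end IsSymmConvexBody

theorem bodyOpNorm_nonneg (A B : Set (EuclideanSpace ℝ (Fin n)))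
    (T : EuclideanSpace ℝ (Fin n) →ₗ[ℝ] EuclideanSpace ℝ (Fin n)) : 0 ≤ bodyOpNorm A B T :=
  Real.sInf_nonneg fun _ h => h.1

theorem bodyOpNorm_id_le {A B : Set (EuclideanSpace ℝ (Fin n))} (hA : IsSymmConvexBody A) {c : ℝ}
    (hc : 0 < c) (h : A ⊆ c • B) : bodyOpNorm A B LinearMap.id ≤ c := by
  refine csInf_le ⟨0, fun _ h => h.1⟩ ⟨hc.le, fun x => ?_⟩
  have habs : Absorbent ℝ A :=
    absorbent_nhds_zero (mem_interior_iff_mem_nhds.1 hA.zero_mem_interior)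
  have h1 := gauge_mono habs h x
  rw [gauge_smul_left_of_nonneg hc.le, Pi.smul_apply, smul_eq_mul, inv_mul_le_iff₀ hc] at h1
  simpa using h1

theorem banachMazurDist_le {A B : Set (EuclideanSpace ℝ (Fin n))} (hA : IsSymmConvexBody A)
    (hB : IsSymmConvexBody B) {c d : ℝ} (hc : 0 < c) (hd : 0 < d) (hdB : d • B ⊆ A)
    (hAc : A ⊆ c • B) : banachMazurDist A B ≤ c / d := by
  have hBA : B ⊆ d⁻¹ • A := by
    intro x hx
    rw [Set.mem_inv_smul_set_iff₀ hd.ne']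
    exact hdB (Set.smul_mem_smul_set hx)
  refine (ciInf_le ⟨0, ?_⟩ (LinearEquiv.refl ℝ _)).trans ?_
  · rintro _ ⟨T, rfl⟩
    exact mul_nonneg (bodyOpNorm_nonneg _ _ _) (bodyOpNorm_nonneg _ _ _)
  · rw [div_eq_mul_inv]
    exact mul_le_mul (bodyOpNorm_id_le hA hc hAc) (bodyOpNorm_id_le hB (inv_pos.2 hd) hBA)
      (bodyOpNorm_nonneg _ _ _) hc.le

theorem IsSymmConvexBody.banachMazurDist_santaloRegion_le (hK : IsSymmConvexBody K) (hn : n ≠ 0)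
    {t : ℝ} (ht : volume.real K * volume.real (polarAt K 0) / unitBallVolume n ^ 2 < t) :
    banachMazurDist (santaloRegion K t) (binetEllipsoid (polarAt K 0)) ≤
      √(6 * t * unitBallVolume n ^ 2 / (volume.real K * volume.real (polarAt K 0))) := by
  have hκ := hK.volume_real_pos
  have hV := hK.polar.volume_real_pos
  have hv := unitBallVolume_pos n
  have ht0 : 0 < t := lt_trans (by positivity) ht
  have hn0 : (0 : ℝ) < n := by exact_mod_cast Nat.pos_of_ne_zero hn
  have hd := hK.innerRadius_pos hn ht
  set c := √(2 / (((n : ℝ) + 1) * ((n : ℝ) + 2))) *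
      √(t * unitBallVolume n ^ 2 / (volume.real K * volume.real (polarAt K 0))) *
      √(1 - volume.real K * volume.real (polarAt K 0) / (t * unitBallVolume n ^ 2)) with hc
  have hs : 0 < √(1 - volume.real K * volume.real (polarAt K 0) / (t * unitBallVolume n ^ 2)) := by
    refine lt_of_le_of_ne (Real.sqrt_nonneg _) fun h => hd.ne ?_
    rw [innerRadius, ← h, mul_zero]
  have hc0 : 0 < c := by positivity
  refine (banachMazurDist_le (hK.santaloRegion hn ht) (hK.polar.binetEllipsoid hn) hc0 hd
    (hK.smul_binetEllipsoid_subset hn ht.le) fun x hx =>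
      hK.polar.mem_smul_binetEllipsoid hc0.le (hK.binetForm_le_first hx)).trans ?_
  have e : c / innerRadius K t = √(2 / (((n : ℝ) + 1) * ((n : ℝ) + 2))) *
      √(t * unitBallVolume n ^ 2 / (volume.real K * volume.real (polarAt K 0))) * (√3 * n) := by
    rw [hc, innerRadius]
    generalize √(1 - volume.real K * volume.real (polarAt K 0) / (t * unitBallVolume n ^ 2)) = σ
      at hs
    field_simp
  rw [e]
  refine Real.le_sqrt_of_sq_le ?_
  rw [mul_pow, mul_pow, mul_pow, Real.sq_sqrt (by positivity), Real.sq_sqrt (by positivity),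
    Real.sq_sqrt (by norm_num)]
  have h1 : (n : ℝ) ^ 2 / ((n + 1) * (n + 2)) ≤ 1 := by
    rw [div_le_one (by positivity)]
    nlinarith
  calc _ = (n : ℝ) ^ 2 / ((n + 1) * (n + 2)) *
        (6 * t * unitBallVolume n ^ 2 / (volume.real K * volume.real (polarAt K 0))) := by
        field_simp
        ring
    _ ≤ 1 * (6 * t * unitBallVolume n ^ 2 / (volume.real K * volume.real (polarAt K 0))) := by
        gcongr
    _ = _ := one_mul _

end Moments

theorem theorem6 {n : ℕ} (hn : 1 ≤ n) (K : Set (EuclideanSpace ℝ (Fin n)))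
    (hK : IsSymmConvexBody K) (t : ℝ) (ht : (santaloRegion K t).Nonempty) :
    volume.real K * volume.real (polarAt K 0) / unitBallVolume n ^ 2 ≤ t ∧
    innerRadius K t • binetEllipsoid (polarAt K 0) ⊆ santaloRegion K t ∧
    santaloRegion K t ⊆ outerRadius K t • binetEllipsoid (polarAt K 0) ∧
    (volume.real K * volume.real (polarAt K 0) / unitBallVolume n ^ 2 < t →
      IsSymmConvexBody (santaloRegion K t) ∧
      IsSymmConvexBody (binetEllipsoid (polarAt K 0)) ∧
      banachMazurDist (santaloRegion K t) (binetEllipsoid (polarAt K 0)) ≤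
        √(6 * t * unitBallVolume n ^ 2 / (volume.real K * volume.real (polarAt K 0)))) := by
  have hn0 : n ≠ 0 := Nat.one_le_iff_ne_zero.1 hn
  obtain ⟨x, hx⟩ := ht
  have hle := hK.le_of_mem_santaloRegion hx
  exact ⟨hle, hK.smul_binetEllipsoid_subset hn0 hle, hK.santaloRegion_subset hn0 t, fun hlt =>
    ⟨hK.santaloRegion hn0 hlt, hK.polar.binetEllipsoid hn0,
      hK.banachMazurDist_santaloRegion_le hn0 hlt⟩⟩
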